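/- **Setting.** Let $T$ be a complete first-order theory in a language $\mathcal L$, and let $\mathfrak C$ be a monster model of $T$ of monstrosity $\mu$: $\mu$ is a strong limit cardinal and $\mathfrak C$ is $\mu$-saturated and strongly $\mu$-homogeneous. A set is *small* if its cardinality is less than $\mu$. Let $\perp\!\!\!\perp$ be a symmetric independence relation on the small subsets of $\mathfrak C$, i.e. a ternary relation $A\perp\!\!\!\perp_B C$ satisfying Invariance (under $\mathrm{Aut}(\mathfrak C)$), Normality ($A\perp\!\!\!\perp_B C\Rightarrow AB\perp\!\!\!\perp_B C$), Symmetry, Transitivity (for $B\subseteq C\subseteq D$: $A\perp\!\!\!\perp_B D$ iff $A\perp\!\!\!\perp_B C$ and $A\perp\!\!\!\perp_C D$), Finite Character (in $A$), Extension (for all $A,B,C$ there is $A'\equiv_B A$ with $A'\perp\!\!\!\perp_B C$) and Local Character (for some small cardinal $\kappa'$, for all $A,C$ there is $C_0\subseteq C$ with $|C_0|<\kappa'+|A|^+$ and $A\perp\!\!\!\perp_{C_0}C$). Let $\kappa_0$ be the least regular cardinal $\nu$ such that for every finite $A$ and small $B$ there is $B_0\subseteq B$ with $|B_0|<\nu$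 and $A\perp\!\!\!\perp_{B_0}B$. Fix a small cardinal $\kappa>\max(\kappa_0,|T|)$, where $|T|=\max(\aleph_0,|\mathcal L|)$, and an infinite cardinal $\lambda\le\kappa$; a set or tuple is *very small* if its cardinality is less than $\lambda$. **Lowness.** For an $\mathcal L$-formula $\varphi(\bar x,\bar y)$ ($\bar x,\bar y$ finite tuples of variables), a finite tuple $\bar b$ and a very small tuple $\bar c$ of $\mathfrak C$, say that $\varphi(\bar x,\bar b)$ *does not fork over* $\bar c$ if there is $\bar a$ in $\mathfrak C$ with $\mathfrak C\models\varphi(\bar a,\bar b)$ and $\bar a\perp\!\!\!\perp_{\bar c}\bar b$; otherwise it forks over $\bar c$. For a very small tuple of variables $\bar z$ put $$\Sigma_{\varphi,\bar z}=\{(\bar b,\bar c):\varphi(\bar x,\bar b)\text{ forks over }\bar c\},\qquad |\bar b|=|\bar y|,\ |\bar c|=|\bar z|.$$ The relation $\perp\!\!\!\perp$ is *low* if for all $\varphi$ and all very small $\bar z$ the set $\Sigma_{\varphi,\bar z}$ is type-definable, that is, defined in $\mathfrak C$ by a partial type $\Gamma_{\varphi,\bar z}(\bar y,\bar z)$ over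 $\emptyset$. **Density.** Let $P$ be a new unary predicate and $\mathcal L^2=\mathcal L\cup\{P\}$; let $T^2$ be $T$ regarded as an $\mathcal L^2$-theory. We consider models $M_P=(M,P(M))$ of $T^2$ with $M\prec\mathfrak C$ small and $P(M)\subseteq M$. Such $M_P$ has the *Density property* if, for every very small $A\subseteq M$, every complete $\mathcal L$-1-type $q$ over $A$ which does not fork over $P(M)\cap A$ (some realization $a\in\mathfrak C$ of $q$ satisfies $a\perp\!\!\!\perp_{P(M)\cap A}A$) is realized in $P(M)$. An $\mathcal L^2$-theory $T'\supseteq T^2$ *axiomatizes* the Density property if every $M_P$ with the Density property is a model of $T'$ and every $\kappa$-saturated $M_P\models T'$ has the Density property. The Density property is *first order* if some $T'$ axiomatizes it. **Statement.** 1. $\perp\!\!\!\perp$ is low if and only if the Density property is first order. 2. Suppose that $\perp\!\!\!\perp$ is low. Then there are partial types $\Gamma_{\varphi,\bar z}(\bar y,\bar z)$ over $\emptyset$ defining the sets $\Sigma_{\varphi,\bar z}$, for all $\mathcal L$-formulas $\varphi(x,\bar y)$ with $x$ a single variable and all very small $\bar z$; and for every choice of such types, $T^2$ together with all the $\mathcal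 L^2$-sentences $$\forall\bar y\ \forall\bar z\in P\ \bigl(\neg\psi(\bar y,\bar z)\rightarrow\exists x\in P\ \varphi(x,\bar y)\bigr)\qquad(\psi\in\Gamma_{\varphi,\bar z}),$$ in which only the finitely many variables of $\bar z$ occurring in $\psi$ are quantified, axiomatizes the Density property. Moreover, $M_P$ satisfies all these sentences if and only if, for all such $\varphi$ and $\bar z$, $$(\forall\bar b\in M)\,(\forall\bar c\in P(M))\ \bigl((\bar b,\bar c)\notin\Sigma_{\varphi,\bar z}\Rightarrow(\exists a\in P(M))\ M\models\varphi(a,\bar b)\bigr).$$ -/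

import Mathlib

open FirstOrder FirstOrder.Language Cardinal

universe u v w

namespace LovelyPairs

section Monster

variable (L : FirstOrder.Language.{u, v}) (M : Type w) [L.Structure M]

/-- `M` is `κ`-saturated: every set of formulas in one variable over a set of fewer than `κ`
parameters which is finitely satisfiable in `M` is realized in `M`. -/
def IsSaturated (κ : Cardinal.{w}) : Prop :=
  ∀ A : Set M, #A < κ → ∀ p : Set (L[[A]].Formula (Fin 1)),
    (∀ s : Finset (L[[A]].Formula (Fin 1)), (s : Set (L[[A]].Formula (Fin 1))) ⊆ p →
      ∃ x : Fin 1 → M, ∀ φ ∈ s, φ.Realize x) →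
    ∃ x : Fin 1 → M, ∀ φ ∈ p, φ.Realize x

/-- `M` is strongly `κ`-homogeneous: any two tuples of the same length less than `κ` and of the
same type over `∅` are conjugate under an automorphism of `M`. -/
def IsStronglyHomogeneous (κ : Cardinal.{w}) : Prop :=
  ∀ (ι : Type w), #ι < κ → ∀ a b : ι → M,
    (∀ φ : L.Formula ι, φ.Realize a ↔ φ.Realize b) → ∃ σ : M ≃[L] M, ∀ i, σ (a i) = b i

/-- `M` is a monster model (of its complete theory) of monstrosity `μ`. Subsets of `M` of
cardinality less than `μ` are called small. -/
structure IsMonster (μ : Cardinal.{w}) : Prop where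
  isStrongLimit : μ.IsStrongLimit
  isSaturated : IsSaturated L M μ
  isStronglyHomogeneous : IsStronglyHomogeneous L M μ

end Monster

section Independence

variable (L : FirstOrder.Language.{u, v}) {C : Type w} [L.Structure C]

/-- Symmetric independence relations on the small subsets of a monster model `C`.
`Ind A B D` stands for: `A` is independent from `D` over `B`. -/
structure IsIndependenceRelation (μ : Cardinal.{w}) (Ind : Set C → Set C → Set C → Prop) :
    Prop where
  invariance : ∀ (σ : C ≃[L] C) (A B D : Set C), #A < μ → #B < μ → #D < μ →
    Ind A B D → Ind (σ '' A) (σ '' B) (σ '' D)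
  normality : ∀ A B D : Set C, #A < μ → #B < μ → #D < μ → Ind A B D → Ind (A ∪ B) B D
  symmetry : ∀ A B D : Set C, #A < μ → #B < μ → #D < μ → Ind A B D → Ind D B A
  transitivity : ∀ A B D E : Set C, #A < μ → #E < μ → B ⊆ D → D ⊆ E →
    (Ind A B E ↔ Ind A B D ∧ Ind A D E)
  finite_character : ∀ A B D : Set C, #A < μ → #B < μ → #D < μ →
    (Ind A B D ↔ ∀ A₀ ⊆ A, A₀.Finite → Ind A₀ B D)
  /-- `A' ≡_B A` is expressed by an automorphism of the monster over `B`. -/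
  extension : ∀ A B D : Set C, #A < μ → #B < μ → #D < μ →
    ∃ σ : C ≃[L] C, (∀ b ∈ B, σ b = b) ∧ Ind (σ '' A) B D
  local_character : ∃ κ₀ < μ, ∀ A D : Set C, #A < μ → #D < μ →
    ∃ D₀ ⊆ D, #D₀ < κ₀ + Order.succ #A ∧ Ind A D₀ D

/-- The smallest regular cardinal `ν` such that every finite set `A` is independent from every
small set `B` over some subset of `B` of cardinality less than `ν`. -/
noncomputable def kappaZero (μ : Cardinal.{w}) (Ind : Set C → Set C → Set C → Prop) :
    Cardinal.{w} :=
  sInf {ν | ν.IsRegular ∧ ∀ A B : Set C, A.Finite → #B < μ →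
    ∃ B₀ ⊆ B, #B₀ < ν ∧ Ind A B₀ B}

/-- The formula `φ(x̄, b̄)` does not fork over (the set enumerated by) the tuple `c̄`: it has a
realization in the monster model which is independent from `b̄` over `c̄`. -/
def NotForks {n m : ℕ} {ι : Type w} (Ind : Set C → Set C → Set C → Prop)
    (φ : L.Formula (Fin n ⊕ Fin m)) (b : Fin m → C) (c : ι → C) : Prop :=
  ∃ a : Fin n → C, φ.Realize (Sum.elim a b) ∧ Ind (Set.range a) (Set.range c) (Set.range b)

/-- The set `Σ_φ(ȳ, z̄)` of the pairs `(b̄, c̄)` such that `φ(x̄, b̄)` forks over `c̄`, where `ȳ` is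
finite and `z̄` is indexed by `ι`. -/
def ForkingSet {n m : ℕ} (ι : Type w) (Ind : Set C → Set C → Set C → Prop)
    (φ : L.Formula (Fin n ⊕ Fin m)) : Set ((Fin m → C) × (ι → C)) :=
  {p | ¬ NotForks L Ind φ p.1 p.2}

/-- The partial type `Γ(ȳ, z̄)` over `∅` defines the set `X` of tuples of the monster model. -/
def Defines {m : ℕ} {ι : Type w} (Γ : Set (L.Formula (Fin m ⊕ ι)))
    (X : Set ((Fin m → C) × (ι → C))) : Prop :=
  ∀ (b : Fin m → C) (c : ι → C), (b, c) ∈ X ↔ ∀ ψ ∈ Γ, ψ.Realize (Sum.elim b c)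

/-- The independence relation is low: for every formula `φ(x̄, ȳ)` and every tuple of variables
`z̄` of length less than `lam`, the set `Σ_φ(ȳ, z̄)` is type-definable. -/
def IsLow (lam : Cardinal.{w}) (Ind : Set C → Set C → Set C → Prop) : Prop :=
  ∀ (n m : ℕ) (φ : L.Formula (Fin n ⊕ Fin m)) (ι : Type w), #ι < lam →
    ∃ Γ : Set (L.Formula (Fin m ⊕ ι)), Defines L Γ (ForkingSet L ι Ind φ)

/-- The complete type of the element `a` over the set `A`. -/
def typeOver [Nonempty C] (A : Set C) (a : C) :
    (L[[A]].completeTheory C).CompleteType (Fin 1) :=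
  Theory.typeOf (L[[A]].completeTheory C) (fun _ : Fin 1 => a)

/-- For a complete type `q` over `A` and `B ⊆ A`: `q` does not fork over `B`, that is, some
realization of `q` in the monster model is independent from `A` over `B`. -/
def TypeNotForks [Nonempty C] (Ind : Set C → Set C → Set C → Prop) {A : Set C}
    (q : (L[[A]].completeTheory C).CompleteType (Fin 1)) (B : Set C) : Prop :=
  ∃ a : C, typeOver L A a = q ∧ Ind {a} B A

end Independence

section Pairs

/-- The only symbol is a unary predicate. -/
inductive PredRel : ℕ → Type
  | P : PredRel 1

/-- The language with one unary predicate symbol. -/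
def predLang : FirstOrder.Language.{0, 0} := ⟨fun _ => Empty, PredRel⟩

/-- The unary predicate symbol `P`. -/
def predSymb : predLang.Relations 1 := PredRel.P

/-- The language `L` with an additional unary predicate symbol `P`. -/
abbrev pairLang (L : FirstOrder.Language.{u, v}) : FirstOrder.Language.{u, v} := L.sum predLang

/-- The theory of all expansions to `pairLang L` of the models of the complete theory of `C`. -/
def pairTheory (L : FirstOrder.Language.{u, v}) (C : Type w) [L.Structure C] : (pairLang L).Theory :=
  (LHom.sumInl : L →ᴸ pairLang L).onTheory (L.completeTheory C)

variable (L : FirstOrder.Language.{u, v}) (C : Type w) [L.Structure C]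

/-- A small elementary substructure `M` of `C` together with a subset `P(M)` of `M`. -/
structure SmallPair (μ : Cardinal.{w}) where
  M : L.ElementarySubstructure C
  P : Set C
  small : #M < μ
  subset : P ⊆ M

variable {L C} {μ : Cardinal.{w}}

/-- The new predicate symbol is interpreted as membership in `P(M)`. -/
instance SmallPair.predStructure (N : SmallPair L C μ) : predLang.Structure N.M where
  funMap f _ := nomatch f
  RelMap r x := match r, x with
    | PredRel.P, x => (x 0 : C) ∈ N.P

/-- The pair satisfies the theory `T'`. -/
def SmallPair.Models (N : SmallPair L C μ) (T' : (pairLang L).Theory) : Prop :=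
  Theory.Model (L := pairLang L) N.M T'

/-- The Density property: for every very small (that is, of cardinality less than `lam`) `A ⊆ M`,
every complete `L`-1-type over `A` which does not fork over `P(A) = P(M) ∩ A` is realized
in `P(M)`. -/
def DensityProperty [Nonempty C] (lam : Cardinal.{w}) (Ind : Set C → Set C → Set C → Prop)
    (N : SmallPair L C μ) : Prop :=
  ∀ A : Set C, A ⊆ N.M → #A < lam → ∀ q : (L[[A]].completeTheory C).CompleteType (Fin 1),
    TypeNotForks L Ind q (N.P ∩ A) → ∃ a ∈ N.P, typeOver L A a = q

/-- The theory `T'` axiomatizes the property `S` of small pairs: it expands `pairTheory L C`,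
all pairs with the property are models of `T'`, and all `κ`-saturated models of `T'` have the
property. -/
def Axiomatizes (κ : Cardinal.{w}) (T' : (pairLang L).Theory) (S : SmallPair L C μ → Prop) :
    Prop :=
  pairTheory L C ⊆ T' ∧ (∀ N, S N → N.Models T') ∧
    ∀ N : SmallPair L C μ, N.Models T' → IsSaturated (pairLang L) N.M κ → S N

/-- The property `S` of small pairs is first order. -/
def IsFirstOrderProperty (κ : Cardinal.{w}) (S : SmallPair L C μ → Prop) : Prop :=
  ∃ T' : (pairLang L).Theory, Axiomatizes κ T' S

end Pairs

section Scheme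

variable {L : FirstOrder.Language.{u, v}}

/-- The formula `P(x)`. -/
def predFormula {α : Type*} (x : α) : (pairLang L).Formula α :=
  Relations.formula₁ ((LHom.sumInr : predLang →ᴸ pairLang L).onRelation predSymb) (Term.var x)

open Classical in
/-- The sentence
`∀ ȳ, ∀ z̄ ∈ P, (¬ ψ(ȳ, z̄) → ∃ x ∈ P, φ(x, ȳ))`,
where only those (finitely many) variables of `z̄` are quantified which occur in `ψ`. -/
noncomputable def densityAxiom {m : ℕ} {ι : Type w} (φ : L.Formula (Fin 1 ⊕ Fin m))
    (ψ : L.Formula (Fin m ⊕ ι)) : (pairLang L).Sentence :=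
  let zs : Finset ι := ψ.freeVarFinset.toRight
  let hyp : (pairLang L).Formula (Fin m ⊕ ι) :=
    Formula.iInf fun j : zs => predFormula (Sum.inr (j : ι))
  let ψ' : (pairLang L).Formula (Fin m ⊕ ι) := LHom.sumInl.onFormula ψ
  let φ' : (pairLang L).Formula ((Fin m ⊕ ι) ⊕ Fin 1) :=
    (LHom.sumInl.onFormula φ).relabel (Sum.elim Sum.inr (Sum.inl ∘ Sum.inl))
  let concl : (pairLang L).Formula (Fin m ⊕ ι) :=
    Formula.iExs (Fin 1) (predFormula (Sum.inr 0) ⊓ φ')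
  let body : (pairLang L).Formula (Fin m ⊕ ι) := hyp.imp (ψ'.not.imp concl)
  body.not.exClosure.not

/-- Partial types `Γ_φ(ȳ, z̄)` over `∅`, for all formulas `φ(x, ȳ)` with `x` a single variable and
all tuples of variables `z̄`. -/
abbrev TypeFamily (L : FirstOrder.Language.{u, v}) :=
  ∀ (m : ℕ) (_ : L.Formula (Fin 1 ⊕ Fin m)) (ι : Type w), Set (L.Formula (Fin m ⊕ ι))

/-- The family `Γ` consists of definitions of the sets `Σ_φ(ȳ, z̄)`, where `z̄` is very small. -/
def DefinesForking {C : Type w} [L.Structure C] (lam : Cardinal.{w})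
    (Ind : Set C → Set C → Set C → Prop) (Γ : TypeFamily.{u, v, w} L) : Prop :=
  ∀ (m : ℕ) (φ : L.Formula (Fin 1 ⊕ Fin m)) (ι : Type w), #ι < lam →
    Defines L (Γ m φ ι) (ForkingSet L ι Ind φ)

/-- The set of all density axioms for `φ(x, ȳ)` and `ψ(ȳ, z̄) ∈ Γ_φ(ȳ, z̄)`, with `z̄` very small. -/
def densityScheme (lam : Cardinal.{w}) (Γ : TypeFamily.{u, v, w} L) : (pairLang L).Theory :=
  {σ | ∃ (m : ℕ) (φ : L.Formula (Fin 1 ⊕ Fin m)) (ι : Type w), #ι < lam ∧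
    ∃ ψ ∈ Γ m φ ι, σ = densityAxiom φ ψ}

/-- The condition
`(∀ b̄) (∀ c̄ ∈ P) ((b̄, c̄) ∉ Σ_φ(ȳ, z̄) → (∃ a ∈ P) φ(a, b̄))`, for all `φ(x, ȳ)` and all
very small `z̄`. -/
def DensityCondition {C : Type w} [L.Structure C] {μ : Cardinal.{w}} (lam : Cardinal.{w})
    (Ind : Set C → Set C → Set C → Prop) (N : SmallPair L C μ) : Prop :=
  ∀ (m : ℕ) (φ : L.Formula (Fin 1 ⊕ Fin m)) (ι : Type w), #ι < lam →
    ∀ (b : Fin m → N.M) (c : ι → N.M), (∀ i, (c i : C) ∈ N.P) →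
      ((fun i => (b i : C)), (fun i => (c i : C))) ∉ ForkingSet L ι Ind φ →
        ∃ a : N.M, (a : C) ∈ N.P ∧ φ.Realize (Sum.elim (fun _ => a) b)

end Scheme

end LovelyPairs

/-!
The set of forking instances of `φ(x̄, ȳ)` is invariant under automorphisms, so it is type-definable
if and only if the corresponding set of types is closed.

Suppose that it is type-definable. For a single variable `x`, the axiom scheme expresses that
`φ(x, b̄)` has a realization in `P` whenever it does not fork over some very small `c̄ ∈ P`
(`models_densityScheme_iff`). The Density property implies this condition
(`DensityProperty.densityCondition`), since a realization independent from `b̄` over `c̄` has a type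
over `b̄c̄` which does not fork over `P ∩ b̄c̄`. Conversely, if a type over `A` does not fork over
`P ∩ A`, then none of its formulas forks over `P ∩ A`, so the condition makes the type finitely
satisfiable in `P`, and a saturated pair realizes it there (`DensityCondition.densityProperty`).

Suppose that the Density property is axiomatized by `T'` but that the forking set of `φ` is not
type-definable. Then some `(b̄₀, c̄₀)` outside of it satisfies every formula which holds on the whole
forking set, that is, every formula true of `(b̄₀, c̄₀)` is true of some `(b̄, c̄)` for which `φ(x̄, b̄)`
forks over `c̄`. Put such `b̄` and `c̄` into a pair with the Density property where `c̄ ∈ P` and `P` is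
independent from `b̄` over `c̄` (`exists_densityProperty`); there `φ(x̄, b̄)` has no realization in `P`.
By compactness, the theory `T'` is consistent with a pair where the type of `(b̄₀, c̄₀)` is realized by
some `(b̄, c̄)` with `c̄ ∈ P`, although `φ(x̄, b̄)` has no realization in `P`. Such a pair can be taken
`κ`-saturated and inside the monster model (`exists_saturated_smallPair`), so that it has the Density
property; but then `φ(x̄, b̄)`, which does not fork over `c̄`, is realized in `P`
(`DensityProperty.exists_realize`).

Both the pairs with the Density property and the saturated pairs are enumerated along a well-order
of type `2 ^ κ`, whose cofinality exceeds `κ`. There are only `2 ^ κ` many tasks, each asking for the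
realization of a set of formulas over at most `κ` elements of the enumeration, so they can be
distributed over the stages (`exists_bookkeeping`).
-/

namespace LovelyPairs

/-! ### Transfinite recursion and bookkeeping -/

/-- Recursion along a well-order: if `R α f` can always be satisfied, then there is a function whose
value at each `α` satisfies `R α f'` for some `f'` agreeing with it below `α`. -/
theorem exists_wellFounded_choice {W : Type*} [LinearOrder W] [WellFoundedLT W] {X : Type*}
    [Nonempty X] (R : W → (W → X) → X → Prop) (hR : ∀ α f, ∃ x, R α f x) :
    ∃ f : W → X, ∀ α, ∃ f' : W → X, (∀ β < α, f' β = f β) ∧ R α f' (f α) := by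
  classical
  choose F hF using hR
  let ext : ∀ α : W, (∀ β, β < α → X) → W → X :=
    fun α g β => if h : β < α then g β h else Classical.arbitrary X
  let f : W → X := (wellFounded_lt (α := W)).fix fun α g => F α (ext α g)
  refine ⟨f, fun α => ⟨ext α fun β _ => f β, fun β hβ => by simp [ext, hβ], ?_⟩⟩
  have : f α = F α (ext α fun β _ => f β) := WellFounded.fix_eq _ _ _
  rw [this]
  exact hF _ _

/-- The stages of the transfinite constructions: a well-order of type `2 ^ κ`. -/
abbrev Stage (κ : Cardinal.{w}) : Type w := ((2 : Cardinal.{w}) ^ κ).ord.ToType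

instance Stage.nonempty (κ : Cardinal.{w}) : Nonempty (Stage κ) :=
  mk_ne_zero_iff.1 ((mk_ord_toType _).trans_ne (power_ne_zero κ two_ne_zero))

theorem Stage.mk (κ : Cardinal.{w}) : #(Stage κ) = 2 ^ κ := by simp [Stage]

theorem Stage.exists_bound {κ : Cardinal.{w}} (hκ : ℵ₀ ≤ κ) {s : Set (Stage κ)} (hs : #s ≤ κ) :
    ∃ β, ∀ α ∈ s, α < β := by
  by_contra h
  push Not at h
  have hc : IsCofinal s := fun β => h β
  have h1 := Order.cof_le hc
  rw [Ordinal.cof_toType] at h1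
  exact absurd (h1.trans hs) (not_le.2 (lt_cof_ord_power hκ one_lt_two))

/-- A task over the variables `V`: a set of formulas `p(ȳ, x)` together with an instantiation of `ȳ`
by variables in `V`, where `ȳ` has length `κ`. -/
abbrev Task (L : FirstOrder.Language.{u, v}) (κ : Cardinal.{w}) (V : Type w) :
    Type (max u v w) :=
  (κ.out → V) × Set (L.Formula (κ.out ⊕ Fin 1))

theorem mk_formula_le {L : FirstOrder.Language.{u, v}} {κ : Cardinal.{w}} (hκ : ℵ₀ ≤ κ)
    (hL : Cardinal.lift.{w} L.card ≤ Cardinal.lift.{max u v} κ) :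
    #(L.Formula (κ.out ⊕ Fin 1)) ≤ Cardinal.lift.{max u v} κ := by
  have hinj : Function.Injective
      (fun φ : L.Formula (κ.out ⊕ Fin 1) =>
        (⟨0, φ⟩ : Σ n, L.BoundedFormula (κ.out ⊕ Fin 1) n)) := fun φ ψ h => by
    simpa using h
  have hκ' : ℵ₀ ≤ Cardinal.lift.{max u v} κ := by simpa using hκ
  refine (mk_le_of_injective hinj).trans (BoundedFormula.card_le.trans ?_)
  refine max_le hκ' ?_
  refine add_le_of_le hκ' ?_ hL
  rw [lift_le, mk_sum]
  simp only [Cardinal.mk_out, mk_fin, Nat.cast_one, lift_one, lift_uzero]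
  exact add_le_of_le hκ le_rfl (one_le_aleph0.trans hκ)

/-- There are at most `2 ^ κ` tasks; the second factor makes each of them occur `2 ^ κ` times. -/
theorem exists_enumeration {L : FirstOrder.Language.{u, v}} {κ : Cardinal.{w}} (hκ : ℵ₀ ≤ κ)
    (hL : Cardinal.lift.{w} L.card ≤ Cardinal.lift.{max u v} κ) {V : Type w} [Nonempty V]
    (hV : #V ≤ 2 ^ κ) :
    ∃ e : Stage κ → Task L κ V × Stage κ, Function.Surjective e := by
  have hW : #(Stage κ) = 2 ^ κ := Stage.mk κ
  have h2 : ℵ₀ ≤ (2 : Cardinal.{w}) ^ κ := hκ.trans (cantor κ).le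
  have h1 : #(κ.out → V) ≤ 2 ^ κ := by
    rw [← power_def, Cardinal.mk_out]
    calc #V ^ κ ≤ (2 ^ κ) ^ κ := power_le_power_right hV
      _ = 2 ^ κ := by rw [← power_mul, mul_eq_self hκ]
  have h3 : #(Set (L.Formula (κ.out ⊕ Fin 1))) ≤ Cardinal.lift.{max u v} (2 ^ κ) := by
    rw [mk_set, lift_power, lift_two]
    exact power_le_power_left two_ne_zero (mk_formula_le hκ hL)
  have h2' : ℵ₀ ≤ Cardinal.lift.{max u v} ((2 : Cardinal.{w}) ^ κ) := by
    rwa [aleph0_le_lift]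
  have hle : Cardinal.lift.{w} #(Task L κ V × Stage κ) ≤
      Cardinal.lift.{max u v w} #(Stage κ) := by
    rw [hW, mk_prod, mk_prod]
    simp only [lift_mul, lift_lift]
    have h2'' : ℵ₀ ≤ Cardinal.lift.{max u v w} ((2 : Cardinal.{w}) ^ κ) := by
      rwa [aleph0_le_lift]
    have e1 : Cardinal.lift.{max u v w} ((2 : Cardinal.{w}) ^ κ) =
        Cardinal.lift.{max u v} ((2 : Cardinal.{w}) ^ κ) :=
      (lift_umax.{w, max u v} ▸ rfl)
    refine mul_le_of_le h2'' (mul_le_of_le h2'' ?_ ?_) ?_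
    · exact lift_le.2 h1
    · rw [lift_id'.{w, max u v w}, e1]
      exact h3
    · rw [hW]
  obtain ⟨i⟩ := Cardinal.lift_mk_le'.1 hle
  exact ⟨Function.invFun i, Function.invFun_surjective i.injective⟩

/-- All tasks over the variables `V ⊕ Stage κ` can be distributed over the stages, in such a way that
each task occurs at a stage later than all those which are mentioned in it. -/
theorem exists_bookkeeping {L : FirstOrder.Language.{u, v}} {κ : Cardinal.{w}} (hκ : ℵ₀ ≤ κ)
    (hL : Cardinal.lift.{w} L.card ≤ Cardinal.lift.{max u v} κ) {V : Type w} (hV : #V ≤ 2 ^ κ) :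
    ∃ task : Stage κ → Task L κ (V ⊕ Stage κ),
      ∀ t, ∃ α, task α = t ∧ ∀ k β, t.1 k = Sum.inr β → β < α := by
  have hW : #(Stage κ) = 2 ^ κ := Stage.mk κ
  have h2 : ℵ₀ ≤ (2 : Cardinal.{w}) ^ κ := hκ.trans (cantor κ).le
  obtain ⟨e, he⟩ := exists_enumeration (L := L) (V := V ⊕ Stage κ) hκ hL (by
    rw [mk_sum, lift_id, lift_id]
    exact add_le_of_le h2 hV hW.le)
  refine ⟨fun α => (e α).1, fun t => ?_⟩
  obtain ⟨β, hβ⟩ := Stage.exists_bound hκ (s := {β | ∃ k, t.1 k = Sum.inr β}) (by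
    choose k hk using fun β : {β | ∃ k, t.1 k = Sum.inr β} => β.2
    have : Function.Injective k := by
      intro β β' h
      have h1 := hk β
      rw [h, hk β'] at h1
      exact Subtype.ext (Sum.inr_injective h1.symm)
    exact (mk_le_of_injective this).trans (Cardinal.mk_out κ).le)
  -- The task `t` occurs `2 ^ κ` many times, so not all of its occurrences lie below `β`.
  by_contra hcon
  push Not at hcon
  have hlt : ∀ α, (e α).1 = t → α < β := fun α hα => by
    obtain ⟨k, γ, h1, h2⟩ := hcon α hα
    exact h2.trans_lt (hβ γ ⟨k, h1⟩)
  choose i hi using fun γ : Stage κ => he (t, γ)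
  have hinj : Function.Injective fun γ => (⟨i γ, hlt _ (by rw [hi])⟩ : Set.Iio β) := by
    intro γ γ' h
    have h1 : i γ = i γ' := congrArg Subtype.val h
    have h2 := hi γ
    rw [h1, hi γ'] at h2
    exact (Prod.ext_iff.1 h2).2.symm
  have h3 := mk_le_of_injective hinj
  rw [hW] at h3
  exact absurd h3 (not_le.2 (mk_Iio_lt β (by simp [Stage]) |>.trans_eq hW))

/-! ### Formulas with few variables and elementary substructures -/

/-- A formula in the variables `X` together with one distinguished variable `x` depends on only
finitely many variables from `X`. -/
theorem exists_finite_variables {L : FirstOrder.Language.{u, v}} {X : Type*}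
    (ψ : L.Formula (X ⊕ Fin 1)) :
    ∃ (m : ℕ) (b : Fin m → X) (φ : L.Formula (Fin 1 ⊕ Fin m)),
      (∀ (M : Type w) [L.Structure M] (y : X → M) (x : Fin 1 → M),
        φ.Realize (Sum.elim x (y ∘ b)) ↔ ψ.Realize (Sum.elim y x)) := by
  classical
  let F := ψ.freeVarFinset.toLeft
  let e := F.equivFin
  refine ⟨F.card, fun i => (e.symm i : X), ψ.restrictFreeVar fun a =>
    match a with
    | ⟨Sum.inl a, h⟩ => Sum.inr (e ⟨a, Finset.mem_toLeft.2 h⟩)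
    | ⟨Sum.inr j, _⟩ => Sum.inl j, fun M _ y x => ?_⟩
  refine BoundedFormula.realize_restrictFreeVar _ ?_
  rintro ⟨a | j, h⟩ <;> simp

/-- Formulas over the set of parameters `A`, as formulas with additional variables from `A`. -/
noncomputable def paramEquiv {L : FirstOrder.Language.{u, v}} {M : Type*} (A : Set M)
    (β : Type*) : L[[A]].Formula β ≃ L.Formula (A ⊕ β) :=
  BoundedFormula.constantsVarsEquiv

theorem realize_paramEquiv {L : FirstOrder.Language.{u, v}} {M : Type*} [L.Structure M]
    {A : Set M} {β : Type*} (φ : L[[A]].Formula β) (x : β → M) :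
    (paramEquiv A β φ).Realize (Sum.elim (fun a => (a : M)) x) ↔ φ.Realize x :=
  BoundedFormula.realize_constantsVarsEquiv

/-- The Tarski–Vaught test, for the set enumerated by `h`. -/
theorem exists_elementarySubstructure {L : FirstOrder.Language.{u, v}} {M : Type*} [L.Structure M]
    {V : Type*} (h : V → M)
    (H : ∀ (φ : L.Formula (V ⊕ Fin 1)), (∃ a : M, φ.Realize (Sum.elim h fun _ => a)) →
      ∃ i, φ.Realize (Sum.elim h fun _ => h i)) :
    ∃ S : L.ElementarySubstructure M, (S : Set M) = Set.range h := by
  have hm : L.MeetsDefinable (Set.range h) := by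
    rintro D ⟨a, ha⟩ ⟨φ, hφ⟩
    have key : ∀ x : M, x ∈ D ↔ φ.Realize fun _ => x := fun x => by
      have := Set.ext_iff.1 hφ fun _ => x
      exact this
    choose g hg using fun x : Set.range h => x.2
    let ψ : L.Formula (V ⊕ Fin 1) :=
      (paramEquiv _ _ φ).relabel (Sum.map g id)
    have hψ : ∀ x : M, ψ.Realize (Sum.elim h fun _ => x) ↔ φ.Realize fun _ => x := fun x => by
      rw [Formula.realize_relabel, ← realize_paramEquiv]
      refine iff_of_eq (congrArg _ (funext ?_))
      rintro (c | j) <;> simp [hg]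
    obtain ⟨i, hi⟩ := H ψ ⟨a, (hψ a).2 ((key a).1 ha)⟩
    exact ⟨h i, (key _).2 ((hψ _).1 hi), i, rfl⟩
  exact ⟨hm.toElementarySubstructure, hm.closure_eq_self⟩

/-- Two elements have the same type over `A` if and only if they satisfy the same formulas with
parameters from `A`. -/
theorem typeOver_eq_iff {L : FirstOrder.Language.{u, v}} {C : Type w} [L.Structure C] [Nonempty C]
    {A : Set C} {a a' : C} :
    typeOver L A a = typeOver L A a' ↔ ∀ φ : L.Formula (A ⊕ Fin 1),
      φ.Realize (Sum.elim (fun x => (x : C)) fun _ => a) ↔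
        φ.Realize (Sum.elim (fun x => (x : C)) fun _ => a') := by
  constructor
  · intro h φ
    obtain ⟨ψ, rfl⟩ := (paramEquiv A (Fin 1)).surjective φ
    have h1 := SetLike.ext_iff.1 h (Formula.equivSentence ψ)
    simp only [typeOver, Theory.CompleteType.formula_mem_typeOf] at h1
    rwa [realize_paramEquiv, realize_paramEquiv]
  · intro h
    refine SetLike.ext fun σ => ?_
    obtain ⟨ψ, rfl⟩ := Formula.equivSentence.surjective σ
    simp only [typeOver, Theory.CompleteType.formula_mem_typeOf]
    rw [← realize_paramEquiv, ← realize_paramEquiv]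
    exact h _

/-! ### Tasks -/

/-- The element `a` realizes the task `t`, where the variables in `V` are interpreted by `h`. -/
def Task.Realizes {L : FirstOrder.Language.{u, v}} {κ : Cardinal.{w}} {V : Type w}
    (t : Task L κ V) {M : Type*} [L.Structure M] (h : V → M) (a : M) : Prop :=
  ∀ φ ∈ t.2, φ.Realize (Sum.elim (h ∘ t.1) fun _ => a)

/-- The task given by a set of formulas in variables from a type `X` which embeds into `κ`. The
positions outside `X` are filled arbitrarily. -/
noncomputable def Task.ofTuple {L : FirstOrder.Language.{u, v}} {κ : Cardinal.{w}} {V : Type w}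
    [Nonempty V] {X : Type*} (j : X ↪ κ.out) (i : X → V) (p : Set (L.Formula (X ⊕ Fin 1))) :
    Task L κ V :=
  (Function.extend j i fun _ => Classical.arbitrary V,
    (fun ψ : L.Formula (X ⊕ Fin 1) => ψ.relabel (Sum.map j id)) '' p)

theorem Task.ofTuple_fst {L : FirstOrder.Language.{u, v}} {κ : Cardinal.{w}} {V : Type w}
    [Nonempty V] {X : Type*} (j : X ↪ κ.out) (i : X → V) (p : Set (L.Formula (X ⊕ Fin 1)))
    (x : X) : (Task.ofTuple j i p).1 (j x) = i x :=
  j.injective.extend_apply i (fun _ => Classical.arbitrary V) x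

theorem Task.realizes_ofTuple {L : FirstOrder.Language.{u, v}} {κ : Cardinal.{w}} {V : Type w}
    [Nonempty V] {X : Type*} (j : X ↪ κ.out) (i : X → V) (p : Set (L.Formula (X ⊕ Fin 1)))
    {M : Type*} [L.Structure M] (h : V → M) (a : M) :
    (Task.ofTuple j i p).Realizes h a ↔ ∀ ψ ∈ p, ψ.Realize (Sum.elim (h ∘ i) fun _ => a) := by
  have key : (Sum.elim (h ∘ (Task.ofTuple j i p).1) fun _ => a) ∘ Sum.map j id =
      Sum.elim (h ∘ i) fun _ : Fin 1 => a := by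
    ext (x | x)
    · simp [Task.ofTuple_fst]
    · simp
  rw [← key]
  simp only [Task.Realizes, Task.ofTuple, Set.forall_mem_image, Formula.realize_relabel]

/-- If every task realizable in `M` is realized by some `h i`, then so is every formula in the
variables `V ⊕ Fin 1`. -/
theorem exists_realize_of_tasks {L : FirstOrder.Language.{u, v}} {κ : Cardinal.{w}} (hκ : ℵ₀ ≤ κ)
    {V : Type w} [Nonempty V] {M : Type*} [L.Structure M] (h : V → M)
    (H : ∀ t : Task L κ V, (∃ a, t.Realizes h a) → ∃ i, t.Realizes h (h i))
    (φ : L.Formula (V ⊕ Fin 1)) (hφ : ∃ a, φ.Realize (Sum.elim h fun _ => a)) :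
    ∃ i, φ.Realize (Sum.elim h fun _ => h i) := by
  obtain ⟨a, ha⟩ := hφ
  obtain ⟨m, b, φ₀, hφ₀⟩ := exists_finite_variables φ
  have : Infinite κ.out := by rwa [infinite_iff, Cardinal.mk_out]
  let j : Fin m ↪ κ.out := Fin.valEmbedding.trans (Infinite.natEmbedding κ.out)
  have key : ∀ x : M, (Task.ofTuple j b {φ₀.relabel Sum.swap}).Realizes h x ↔
      φ.Realize (Sum.elim h fun _ => x) := fun x => by
    rw [Task.realizes_ofTuple, ← hφ₀]
    simp only [Set.mem_singleton_iff, forall_eq, Formula.realize_relabel]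
    refine iff_of_eq (congrArg _ (funext ?_))
    rintro (_ | _) <;> rfl
  obtain ⟨i, hi⟩ := H _ ⟨a, (key a).2 ha⟩
  exact ⟨i, (key _).1 hi⟩

/-! ### Automorphisms of the monster model -/

section Monster

variable {L : FirstOrder.Language.{u, v}} {C : Type w} [L.Structure C] {μ : Cardinal.{w}}

theorem IsMonster.exists_equiv_of_typeOver_eq [Nonempty C] (hC : IsMonster L C μ) {A : Set C}
    (hA : #A < μ) {a a' : C} (h : typeOver L A a = typeOver L A a') :
    ∃ σ : C ≃[L] C, (∀ x ∈ A, σ x = x) ∧ σ a = a' := by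
  have hμ : ℵ₀ ≤ μ := hC.isStrongLimit.aleph0_le
  obtain ⟨σ, hσ⟩ := hC.isStronglyHomogeneous (A ⊕ ULift.{w} (Fin 1))
    (by
      rw [mk_sum, lift_id, lift_id]
      refine add_lt_of_lt hμ hA ?_
      simpa using one_lt_aleph0.trans_le hμ)
    (Sum.elim (fun x => (x : C)) fun _ => a) (Sum.elim (fun x => (x : C)) fun _ => a')
    (fun φ => by
      have h1 := typeOver_eq_iff.1 h (φ.relabel (Sum.map id ULift.down))
      simp only [Formula.realize_relabel] at h1
      convert h1 using 2 <;> · ext (_ | _) <;> rfl)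
  exact ⟨σ, fun x hx => hσ (Sum.inl ⟨x, hx⟩), hσ (Sum.inr ⟨0⟩)⟩

theorem typeOver_map [Nonempty C] {A : Set C} (σ : C ≃[L] C) (hσ : ∀ x ∈ A, σ x = x) (a : C) :
    typeOver L A (σ a) = typeOver L A a := by
  rw [typeOver_eq_iff]
  intro φ
  rw [← StrongHomClass.realize_formula σ (v := Sum.elim (fun x : A => (x : C)) fun _ => a)]
  refine iff_of_eq (congrArg _ (funext ?_))
  rintro (x | _)
  · exact (hσ x x.2).symm
  · rfl

end Monster

/-! ### Calculus of independence -/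

namespace IsIndependenceRelation

variable {L : FirstOrder.Language.{u, v}} {C : Type w} [L.Structure C] {μ : Cardinal.{w}}
  {Ind : Set C → Set C → Set C → Prop}

theorem mk_union_lt (hμ : ℵ₀ ≤ μ) {A B : Set C} (hA : #A < μ) (hB : #B < μ) :
    #(A ∪ B : Set C) < μ :=
  (mk_union_le A B).trans_lt (add_lt_of_lt hμ hA hB)

theorem mono_left (hI : IsIndependenceRelation L μ Ind) {A A' B D : Set C} (hA : #A < μ)
    (hB : #B < μ) (hD : #D < μ) (h : A' ⊆ A) (hi : Ind A B D) : Ind A' B D :=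
  (hI.finite_character A' B D ((mk_le_mk_of_subset h).trans_lt hA) hB hD).2 fun A₀ h₀ hf =>
    (hI.finite_character A B D hA hB hD).1 hi A₀ (h₀.trans h) hf

theorem mono_right (hI : IsIndependenceRelation L μ Ind) {A B D D' : Set C} (hA : #A < μ)
    (hB : #B < μ) (hD : #D < μ) (h : D' ⊆ D) (hi : Ind A B D) : Ind A B D' :=
  hI.symmetry _ _ _ ((mk_le_mk_of_subset h).trans_lt hD) hB hA
    (hI.mono_left hD hB hA h (hI.symmetry _ _ _ hA hB hD hi))

theorem base_mono (hI : IsIndependenceRelation L μ Ind) {A B D E : Set C} (hA : #A < μ)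
    (hE : #E < μ) (hBD : B ⊆ D) (hDE : D ⊆ E) (hi : Ind A B E) : Ind A D E :=
  ((hI.transitivity A B D E hA hE hBD hDE).1 hi).2

theorem trans (hI : IsIndependenceRelation L μ Ind) {A B D E : Set C} (hA : #A < μ)
    (hE : #E < μ) (hBD : B ⊆ D) (hDE : D ⊆ E) (h1 : Ind A B D) (h2 : Ind A D E) : Ind A B E :=
  (hI.transitivity A B D E hA hE hBD hDE).2 ⟨h1, h2⟩

theorem union_base (hI : IsIndependenceRelation L μ Ind) (hμ : ℵ₀ ≤ μ) {A B D : Set C}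
    (hA : #A < μ) (hB : #B < μ) (hD : #D < μ) (hi : Ind A B D) : Ind A B (D ∪ B) :=
  hI.symmetry _ _ _ (mk_union_lt hμ hD hB) hB hA
    (hI.normality _ _ _ hD hB hA (hI.symmetry _ _ _ hA hB hD hi))

/-- `B` is independent over itself from everything: no automorphism over `B` moves it. -/
theorem base_self (hI : IsIndependenceRelation L μ Ind) {B D : Set C} (hB : #B < μ)
    (hD : #D < μ) : Ind B B D := by
  obtain ⟨σ, hσ, h⟩ := hI.extension B B D hB hB hD
  have : σ '' B = B := by
    rw [Set.image_congr hσ, Set.image_id']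
  rwa [this] at h

/-- Adding to `P` an element which is independent over `P` from a set containing `P` and `B`
preserves independence from `B`. -/
theorem union_singleton (hI : IsIndependenceRelation L μ Ind) (hμ : ℵ₀ ≤ μ) {P B D M : Set C}
    {a : C} (hM : #M < μ) (hDP : D ⊆ P) (hPM : P ⊆ M) (hBM : B ⊆ M) (h1 : Ind P D B)
    (h2 : Ind {a} P M) : Ind ({a} ∪ P) D B := by
  have hP : #P < μ := (mk_le_mk_of_subset hPM).trans_lt hM
  have hB : #B < μ := (mk_le_mk_of_subset hBM).trans_lt hM
  have hD : #D < μ := (mk_le_mk_of_subset hDP).trans_lt hP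
  have ha : #({a} : Set C) < μ := by simpa using one_lt_aleph0.trans_le hμ
  have haP := mk_union_lt hμ ha hP
  have h3 : Ind B P ({a} ∪ P) := hI.union_base hμ hB hP ha
    (hI.symmetry _ _ _ ha hP hB (hI.mono_right ha hP hM hBM h2))
  exact hI.symmetry _ _ _ hB hD haP (hI.trans hB haP hDP Set.subset_union_right
    (hI.symmetry _ _ _ hP hD hB h1) h3)

end IsIndependenceRelation

/-! ### Pairs with the Density property -/

section DensityPair

variable {L : FirstOrder.Language.{u, v}} {C : Type w} [L.Structure C] [Nonempty C]
  {μ κ lam : Cardinal.{w}} {Ind : Set C → Set C → Set C → Prop}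

/-- There are pairs with the Density property whose predicate contains a given set `D` and is
independent over `D` from a given subset `B` of the model. -/
theorem exists_densityProperty (hC : IsMonster L C μ) (hInd : IsIndependenceRelation L μ Ind)
    (hκ : ℵ₀ ≤ κ) (hL : Cardinal.lift.{w} L.card ≤ Cardinal.lift.{max u v} κ) (hκμ : κ < μ)
    (hlam : lam ≤ κ) {B D : Set C} (hB : #B ≤ κ) (hD : #D ≤ κ) :
    ∃ N : SmallPair L C μ, DensityProperty lam Ind N ∧ B ⊆ N.M ∧ D ⊆ N.P ∧ Ind N.P D B := by
  have hμ : ℵ₀ ≤ μ := hC.isStrongLimit.aleph0_le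
  have hθ : (2 : Cardinal.{w}) ^ κ < μ := hC.isStrongLimit.isStrongPrelimit hκμ
  have hBμ := hB.trans_lt hκμ
  have hDμ := hD.trans_lt hκμ
  have hW : #(Stage κ) = 2 ^ κ := Stage.mk κ
  have hV₀ : #(B ∪ D : Set C) ≤ 2 ^ κ :=
    ((mk_union_le B D).trans (add_le_of_le hκ hB hD)).trans (cantor κ).le
  obtain ⟨task, htask⟩ := exists_bookkeeping (L := L) (V := ↥(B ∪ D)) hκ hL hV₀
  -- Stage `β` adds the element `(f β).1` to the model, and to the predicate if `(f β).2` holds. The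
  -- enumeration of the model is `h f`; its part before stage `α` is `M f α`, with predicate `P f α`.
  let h : (Stage κ → C × Prop) → ↥(B ∪ D) ⊕ Stage κ → C :=
    fun f => Sum.elim (fun x => (x : C)) fun β => (f β).1
  let P : (Stage κ → C × Prop) → Stage κ → Set C :=
    fun f α => D ∪ {x | ∃ β < α, (f β).2 ∧ (f β).1 = x}
  let M : (Stage κ → C × Prop) → Stage κ → Set C :=
    fun f α => (B ∪ D) ∪ {x | ∃ β < α, (f β).1 = x}
  -- The new element realizes the task if possible, and it enters the predicate, independently from
  -- everything before, if the task has a realization which is independent in this way.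
  let R : Stage κ → (Stage κ → C × Prop) → C × Prop → Prop := fun α f x =>
    (x.2 → Ind {x.1} (P f α) (M f α)) ∧
    ((∃ a, (task α).Realizes (h f) a) → (task α).Realizes (h f) x.1) ∧
    ((∃ a, (task α).Realizes (h f) a ∧ Ind {a} (P f α) (M f α)) → x.2)
  have hR : ∀ α f, ∃ x, R α f x := by
    intro α f
    by_cases h1 : ∃ a, (task α).Realizes (h f) a ∧ Ind {a} (P f α) (M f α)
    · obtain ⟨a, ha, hi⟩ := h1
      exact ⟨(a, True), fun _ => hi, fun _ => ha, fun _ => trivial⟩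
    · by_cases h2 : ∃ a, (task α).Realizes (h f) a
      · obtain ⟨a, ha⟩ := h2
        exact ⟨(a, False), fun h => h.elim, fun _ => ha, h1⟩
      · exact ⟨(Classical.arbitrary C, False), fun h => h.elim, fun h => (h2 h).elim, h1⟩
  obtain ⟨f, hf⟩ := exists_wellFounded_choice R hR
  have hMeq : ∀ f' α, (∀ β < α, f' β = f β) → M f' α = M f α := fun f' α hf' => by
    refine Set.ext fun x => or_congr Iff.rfl (exists_congr fun β => and_congr_right fun hβ => ?_)
    rw [hf' β hβ]
  have hPeq : ∀ f' α, (∀ β < α, f' β = f β) → P f' α = P f α := fun f' α hf' => by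
    refine Set.ext fun x => or_congr Iff.rfl (exists_congr fun β => and_congr_right fun hβ => ?_)
    rw [hf' β hβ]
  have hind : ∀ α, (f α).2 → Ind {(f α).1} (P f α) (M f α) := fun α hα => by
    obtain ⟨f', hf', h1, -, -⟩ := hf α
    rw [← hMeq f' α hf', ← hPeq f' α hf']
    exact h1 hα
  have hreal : ∀ t : Task L κ (↥(B ∪ D) ⊕ Stage κ), ∃ α, (∀ k β, t.1 k = Sum.inr β → β < α) ∧
      ((∃ a, t.Realizes (h f) a) → t.Realizes (h f) (f α).1) ∧
      ((∃ a, t.Realizes (h f) a ∧ Ind {a} (P f α) (M f α)) → (f α).2) := fun t => by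
    obtain ⟨α, rfl, hα⟩ := htask t
    obtain ⟨f', hf', -, h2, h3⟩ := hf α
    have hr : ∀ a, (task α).Realizes (h f') a ↔ (task α).Realizes (h f) a := fun a => by
      have : h f' ∘ (task α).1 = h f ∘ (task α).1 := by
        ext k
        rcases hk : (task α).1 k with x | β
        · simp [h, hk]
        · simp [h, hk, hf' β (hα k β hk)]
      rw [Task.Realizes, Task.Realizes, this]
    simp only [hr, hMeq f' α hf', hPeq f' α hf'] at h2 h3
    exact ⟨α, hα, h2, h3⟩
  obtain ⟨S, hS⟩ := exists_elementarySubstructure (h f) <|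
      exists_realize_of_tasks hκ (h f) fun t ht => by
    obtain ⟨α, -, h2, -⟩ := hreal t
    exact ⟨Sum.inr α, h2 ht⟩
  have hMα : ∀ α, M f α ⊆ Set.range (h f) := by
    rintro α x (hx | ⟨β, -, rfl⟩)
    · exact ⟨Sum.inl ⟨x, hx⟩, rfl⟩
    · exact ⟨Sum.inr β, rfl⟩
  have hPM : ∀ α, P f α ⊆ M f α := by
    rintro α x (hx | ⟨β, hβ, -, rfl⟩)
    · exact Or.inl (Or.inr hx)
    · exact Or.inr ⟨β, hβ, rfl⟩
  have hsmall : #(Set.range (h f)) < μ := by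
    refine mk_range_le.trans_lt ?_
    rw [mk_sum, lift_id, lift_id]
    exact add_lt_of_lt hμ (hV₀.trans_lt hθ) (hW.trans_lt hθ)
  have hMμ : ∀ α, #(M f α) < μ := fun α => (mk_le_mk_of_subset (hMα α)).trans_lt hsmall
  have hPμ : ∀ α, #(P f α) < μ := fun α => (mk_le_mk_of_subset (hPM α)).trans_lt (hMμ α)
  let Q : Set C := D ∪ {x | ∃ β, (f β).2 ∧ (f β).1 = x}
  have hQ : Q ⊆ Set.range (h f) := by
    rintro x (hx | ⟨β, -, rfl⟩)
    · exact ⟨Sum.inl ⟨x, Or.inr hx⟩, rfl⟩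
    · exact ⟨Sum.inr β, rfl⟩
  have hQμ : #Q < μ := (mk_le_mk_of_subset hQ).trans_lt hsmall
  have hPmono : ∀ α β, α ≤ β → P f α ⊆ P f β := by
    rintro α β hαβ x (hx | ⟨γ, hγ, h1⟩)
    · exact Or.inl hx
    · exact Or.inr ⟨γ, hγ.trans_le hαβ, h1⟩
  -- A finite subset of the predicate is contained in `D` or in the predicate just after some stage.
  have hfin : ∀ (E : Set C), E.Finite → ∀ U : Set (Stage κ),
      E ⊆ D ∪ {x | ∃ β ∈ U, (f β).2 ∧ (f β).1 = x} →
      E ⊆ D ∨ ∃ β ∈ U, (f β).2 ∧ E ⊆ {(f β).1} ∪ P f β := by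
    intro E hE U
    induction E, hE using Set.Finite.induction_on with
    | empty => exact fun _ => Or.inl (Set.empty_subset _)
    | @insert x E hx hE ih =>
      intro hsub
      have hxE := hsub (Set.mem_insert x E)
      have ih := ih ((Set.subset_insert x E).trans hsub)
      rcases hxE with hxD | ⟨β, hβU, hβ, rfl⟩
      · rcases ih with h1 | ⟨γ, hγU, hγ, h1⟩
        · exact Or.inl (Set.insert_subset hxD h1)
        · exact Or.inr ⟨γ, hγU, hγ, Set.insert_subset (Or.inr (Or.inl hxD)) h1⟩
      · rcases ih with h1 | ⟨γ, hγU, hγ, h1⟩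
        · exact Or.inr ⟨β, hβU, hβ, Set.insert_subset (Or.inl rfl) fun y hy =>
            Or.inr (Or.inl (h1 hy))⟩
        · rcases lt_trichotomy β γ with hlt | rfl | hlt
          · exact Or.inr ⟨γ, hγU, hγ, Set.insert_subset (Or.inr (Or.inr ⟨β, hlt, hβ, rfl⟩)) h1⟩
          · exact Or.inr ⟨β, hβU, hβ, Set.insert_subset (Or.inl rfl) h1⟩
          · refine Or.inr ⟨β, hβU, hβ, Set.insert_subset (Or.inl rfl) fun y hy => ?_⟩
            rcases h1 hy with rfl | hy'
            · exact Or.inr (Or.inr ⟨γ, hlt, hγ, rfl⟩)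
            · exact Or.inr (hPmono γ β hlt.le hy')
  have hDB : Ind D D B := hInd.base_self hDμ hBμ
  have hnext : ∀ α, Ind (P f α) D B → (f α).2 → Ind ({(f α).1} ∪ P f α) D B := fun α hα h2 =>
    hInd.union_singleton hμ (hMμ α) Set.subset_union_left (hPM α)
      (fun x hx => Or.inl (Or.inl hx)) hα (hind α h2)
  have hone : ∀ x : C, #({x} : Set C) < μ := fun x => by simpa using one_lt_aleph0.trans_le hμ
  have hPα : ∀ α, Ind (P f α) D B := fun α => by
    induction α using WellFoundedLT.induction with
    | ind α ih =>
      refine (hInd.finite_character _ _ _ (hPμ α) hDμ hBμ).2 fun E hE hEf => ?_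
      rcases hfin E hEf (Set.Iio α) hE with h1 | ⟨β, hβ, h2, h1⟩
      · exact hInd.mono_left hDμ hDμ hBμ h1 hDB
      · exact hInd.mono_left (IsIndependenceRelation.mk_union_lt hμ (hone _) (hPμ β)) hDμ hBμ h1
          (hnext β (ih β hβ) h2)
  refine ⟨⟨S, Q, ?_, ?_⟩, ?_, ?_, Set.subset_union_left, ?_⟩
  · exact (congrArg (fun s : Set C => #s) hS).trans_lt hsmall
  · rw [hS]; exact hQ
  · rintro A hAM hA q ⟨a, rfl, ha⟩
    replace hAM : A ⊆ Set.range (h f) := hS ▸ hAM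
    have hAκ : #A ≤ κ := hA.le.trans hlam
    have hAμ : #A < μ := hAκ.trans_lt hκμ
    -- Elements of the predicate outside `D` are to be mentioned through a stage adding them.
    have hidx : ∀ x : A, ∃ i, h f i = x ∧ ((x : C) ∈ Q → (x : C) ∉ D →
        ∃ β, i = Sum.inr β ∧ (f β).2) := by
      intro x
      by_cases hx : (x : C) ∈ Q ∧ (x : C) ∉ D
      · obtain ⟨hx1 | ⟨β, hβ, hx1⟩, hx2⟩ := hx
        · exact absurd hx1 hx2
        · exact ⟨Sum.inr β, hx1, fun _ _ => ⟨β, rfl, hβ⟩⟩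
      · obtain ⟨i, hi⟩ := hAM x.2
        exact ⟨i, hi, fun h1 h2 => absurd ⟨h1, h2⟩ hx⟩
    choose i hi hiQ using hidx
    obtain ⟨j⟩ : Nonempty (A ↪ κ.out) := by rwa [← Cardinal.le_def, Cardinal.mk_out]
    let t : Task L κ (↥(B ∪ D) ⊕ Stage κ) := Task.ofTuple j i
      {ψ | ψ.Realize (Sum.elim (fun x : A => (x : C)) fun _ => a)}
    have hhi : h f ∘ i = fun x : A => (x : C) := funext hi
    have ht : ∀ a', t.Realizes (h f) a' ↔ typeOver L A a' = typeOver L A a := fun a' => by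
      rw [Task.realizes_ofTuple, hhi, typeOver_eq_iff]
      refine ⟨fun h1 φ => ⟨fun h2 => ?_, h1 φ⟩, fun h1 ψ hψ => (h1 ψ).2 hψ⟩
      by_contra h3
      exact h1 φ.not h3 h2
    obtain ⟨α, hα, h2, h3⟩ := hreal t
    have hQA : Q ∩ A ⊆ P f α := by
      rintro x ⟨hxQ, hxA⟩
      by_cases hxD : x ∈ D
      · exact Or.inl hxD
      · obtain ⟨β, hβ, hβ2⟩ := hiQ ⟨x, hxA⟩ hxQ hxD
        refine Or.inr ⟨β, hα (j ⟨x, hxA⟩) β ?_, hβ2, ?_⟩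
        · rw [← hβ]
          exact Task.ofTuple_fst j i _ _
        · have hx := hi ⟨x, hxA⟩
          rwa [hβ] at hx
    obtain ⟨σ, hσ, hσi⟩ := hInd.extension {a} A (M f α) (hone a) hAμ (hMμ α)
    have hσa : typeOver L A (σ a) = typeOver L A a := typeOver_map σ hσ a
    have hAM' := IsIndependenceRelation.mk_union_lt hμ (hMμ α) hAμ
    have hQAμ : #(Q ∩ A : Set C) < μ := (mk_le_mk_of_subset Set.inter_subset_right).trans_lt hAμ
    have hi1 : Ind {σ a} (Q ∩ A) A := by
      have := hInd.invariance σ _ _ _ (hone a) hQAμ hAμ ha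
      rwa [Set.image_singleton, Set.image_congr fun x hx => hσ x hx.2,
        Set.image_congr hσ, Set.image_id', Set.image_id'] at this
    have hi2 : Ind {σ a} A (M f α ∪ A) := by
      rw [Set.image_singleton] at hσi
      exact hInd.union_base hμ (hone _) hAμ (hMμ α) hσi
    have hi3 : Ind {σ a} (P f α) (M f α) := by
      have h4 := hInd.trans (hone _) hAM' Set.inter_subset_right Set.subset_union_right hi1 hi2
      exact hInd.base_mono (hone _) (hMμ α) hQA (hPM α)
        (hInd.mono_right (hone _) hQAμ hAM' Set.subset_union_left h4)
    exact ⟨(f α).1, Or.inr ⟨α, h3 ⟨σ a, (ht _).2 hσa, hi3⟩, rfl⟩,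
      (ht _).1 (h2 ⟨a, (ht a).2 rfl⟩)⟩
  · intro x hx
    change x ∈ (S : Set C)
    rw [hS]
    exact ⟨Sum.inl ⟨x, Or.inl hx⟩, rfl⟩
  · refine (hInd.finite_character _ _ _ hQμ hDμ hBμ).2 fun E hE hEf => ?_
    rcases hfin E hEf Set.univ (hE.trans fun x hx => hx.imp_right fun ⟨β, hβ⟩ =>
      ⟨β, trivial, hβ⟩) with h1 | ⟨β, -, h2, h1⟩
    · exact hInd.mono_left hDμ hDμ hBμ h1 hDB
    · exact hInd.mono_left (IsIndependenceRelation.mk_union_lt hμ (hone _) (hPμ β)) hDμ hBμ h1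
        (hnext β (hPα β) h2)

end DensityPair

/-! ### Saturated models of bounded size -/

section Saturated

variable {L : FirstOrder.Language.{u, v}} {V : Type w}

/-- The set `S` of formulas in the variables `V` can be realized in a model of `T`. -/
def Consistent (T : L.Theory) (S : Set (L.Formula V)) : Prop :=
  ((L.lhomWithConstants V).onTheory T ∪ Formula.equivSentence '' S).IsSatisfiable

theorem Consistent.of_model {T : L.Theory} {S : Set (L.Formula V)} (M : Type*) [L.Structure M]
    [Nonempty M] [M ⊨ T] (x : V → M) (h : ∀ φ ∈ S, φ.Realize x) : Consistent T S := by
  let := constantsOn.structure x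
  have h1 : M ⊨ (L.lhomWithConstants V).onTheory T := (LHom.onTheory_model _ T).2 inferInstance
  have h2 : M ⊨ (Formula.equivSentence '' S : L[[V]].Theory) := by
    refine Theory.model_iff _ |>.2 ?_
    rintro _ ⟨φ, hφ, rfl⟩
    exact (Formula.realize_equivSentence M φ).2 (h φ hφ)
  have : M ⊨ (L.lhomWithConstants V).onTheory T ∪ Formula.equivSentence '' S := h1.union h2
  exact Theory.Model.isSatisfiable M

theorem Consistent.exists_model {T : L.Theory} {S : Set (L.Formula V)} (h : Consistent T S) :
    ∃ (M : Theory.ModelType.{u, v, max u v w} T) (x : V → M), ∀ φ ∈ S, φ.Realize x := by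
  obtain ⟨N⟩ := h
  let : L.Structure N := (L.lhomWithConstants V).reduct N
  have : (L.lhomWithConstants V).IsExpansionOn N := LHom.isExpansionOn_reduct _ _
  have h1 : N ⊨ (L.lhomWithConstants V).onTheory T := N.is_model.mono Set.subset_union_left
  have h2 : N ⊨ T := (LHom.onTheory_model _ T).1 h1
  refine ⟨Theory.ModelType.of T N, fun a => (L.con a : N), fun φ hφ => ?_⟩
  exact (Formula.realize_equivSentence N φ).1
    (N.is_model.realize_of_mem _ (Or.inr ⟨φ, hφ, rfl⟩))

/-- Compactness. -/
theorem Consistent.of_finite {T : L.Theory} {S₁ S₂ : Set (L.Formula V)}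
    (h : ∀ s : Finset (L.Formula V), (s : Set (L.Formula V)) ⊆ S₂ → Consistent T (S₁ ∪ s)) :
    Consistent T (S₁ ∪ S₂) := by
  classical
  refine Theory.isSatisfiable_iff_isFinitelySatisfiable.2 fun T₀ hT₀ => ?_
  let s : Finset (L.Formula V) := (T₀.image Formula.equivSentence.symm).filter (· ∈ S₂)
  refine (h s fun φ hφ => (Finset.mem_filter.1 hφ).2).mono fun σ hσ => ?_
  rcases hT₀ hσ with h1 | ⟨φ, h1 | h1, rfl⟩
  · exact Or.inl h1
  · exact Or.inr ⟨φ, Or.inl h1, rfl⟩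
  · refine Or.inr ⟨φ, Or.inr (Finset.mem_coe.2 (Finset.mem_filter.2 ⟨?_, h1⟩)), rfl⟩
    exact Finset.mem_image.2 ⟨_, hσ, by simp⟩

/-- Every consistent set of formulas in at most `2 ^ κ` variables is realized in a model with an
enumeration of length `2 ^ κ` by which every finitely satisfiable task is realized. -/
theorem exists_model_realizing_tasks {κ : Cardinal.{w}} (hκ : ℵ₀ ≤ κ)
    (hL : Cardinal.lift.{w} L.card ≤ Cardinal.lift.{max u v} κ) (hV : #V ≤ 2 ^ κ) {T : L.Theory}
    {S : Set (L.Formula V)} (hS : Consistent T S) :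
    ∃ (N : Theory.ModelType.{u, v, max u v w} T) (x : V ⊕ Stage κ → N),
      (∀ φ ∈ S, φ.Realize (x ∘ Sum.inl)) ∧
      ∀ t : Task L κ (V ⊕ Stage κ),
        (∀ s : Finset (L.Formula (κ.out ⊕ Fin 1)), (s : Set (L.Formula (κ.out ⊕ Fin 1))) ⊆ t.2 →
          ∃ a : N, ∀ φ ∈ s, φ.Realize (Sum.elim (x ∘ t.1) fun _ => a)) →
        ∃ i, t.Realizes x (x i) := by
  classical
  obtain ⟨task, htask⟩ := exists_bookkeeping (L := L) hκ hL hV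
  let S₀ : Set (L.Formula (V ⊕ Stage κ)) := (fun φ : L.Formula V => φ.relabel Sum.inl) '' S
  -- The formulas stating that the variable `β` realizes the task of stage `β`. They are accepted
  -- (`f β` below) if they are consistent with all that has been accepted before.
  let inst : Stage κ → Set (L.Formula (V ⊕ Stage κ)) := fun β =>
    (fun φ : L.Formula (κ.out ⊕ Fin 1) =>
      φ.relabel (Sum.elim (task β).1 fun _ => Sum.inr β)) '' (task β).2
  let Γ : (Stage κ → Prop) → Stage κ → Set (L.Formula (V ⊕ Stage κ)) := fun f α =>
    S₀ ∪ {χ | ∃ β < α, f β ∧ χ ∈ inst β}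
  let R : Stage κ → (Stage κ → Prop) → Prop → Prop := fun α f x =>
    x ↔ (∀ k β, (task α).1 k = Sum.inr β → β < α) ∧ Consistent T (Γ f α ∪ inst α)
  obtain ⟨f, hf⟩ := exists_wellFounded_choice R fun α f => ⟨_, Iff.rfl⟩
  have hfα : ∀ α, f α ↔ (∀ k β, (task α).1 k = Sum.inr β → β < α) ∧
      Consistent T (Γ f α ∪ inst α) := fun α => by
    obtain ⟨f', hf', h⟩ := hf α
    have : Γ f' α = Γ f α := by
      refine Set.ext fun x => or_congr Iff.rfl (exists_congr fun β => and_congr_right fun hβ => ?_)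
      rw [hf' β hβ]
    rw [← this]
    exact h
  have hS₀ : Consistent T S₀ := by
    obtain ⟨M, x, hx⟩ := hS.exists_model
    obtain ⟨m⟩ : Nonempty M := inferInstance
    refine Consistent.of_model M (Sum.elim x fun _ => m) ?_
    rintro _ ⟨φ, hφ, rfl⟩
    simpa using hx φ hφ
  have hΓ : Consistent T (S₀ ∪ {χ | ∃ β, f β ∧ χ ∈ inst β}) := by
    refine Consistent.of_finite fun s hs => ?_
    rcases s.eq_empty_or_nonempty with rfl | hne
    · simpa using hS₀
    choose! b hb using fun χ (hχ : χ ∈ s) => hs hχ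
    obtain ⟨χ₀, hχ₀, hmax⟩ := s.exists_max_image b hne
    refine ((hfα _).1 (hb χ₀ hχ₀).1).2.mono (Set.union_subset_union_right _ (Set.image_mono ?_))
    rintro χ (hχ | hχ)
    · exact Or.inl (Or.inl hχ)
    · rcases (hmax χ hχ).lt_or_eq with h1 | h1
      · exact Or.inl (Or.inr ⟨b χ, h1, hb χ hχ⟩)
      · exact Or.inr (h1 ▸ (hb χ hχ).2)
  obtain ⟨N, x, hx⟩ := hΓ.exists_model
  refine ⟨N, x, fun φ hφ => ?_, fun t ht => ?_⟩
  · simpa using hx _ (Or.inl ⟨φ, hφ, rfl⟩)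
  obtain ⟨α, rfl, hα⟩ := htask t
  have hinst : ∀ y : V ⊕ Stage κ → N, ∀ β,
      y ∘ (Sum.elim (task β).1 fun _ : Fin 1 => Sum.inr β) =
        Sum.elim (y ∘ (task β).1) fun _ => y (Sum.inr β) := fun y β => by
    ext (_ | _) <;> rfl
  -- The variable `α` does not occur in what has been accepted before stage `α`, so that it can be
  -- reinterpreted by a realization of any finite part of the task.
  have hacc : f α := by
    refine (hfα α).2 ⟨hα, Consistent.of_finite fun s hs => ?_⟩
    obtain ⟨s', hs', rfl⟩ := Finset.subset_set_image_iff.1 hs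
    obtain ⟨a, ha⟩ := ht s' hs'
    have hupd : ∀ β ≤ α, (∀ k γ, (task β).1 k = Sum.inr γ → γ < β) →
        Function.update x (Sum.inr α) a ∘ (task β).1 = x ∘ (task β).1 := fun β hβ h => by
      ext k
      refine Function.update_of_ne (fun h1 => ?_) _ _
      exact (h k α h1).not_ge hβ
    refine Consistent.of_model N (Function.update x (Sum.inr α) a) ?_
    rintro χ ((⟨φ, hφ, rfl⟩ | ⟨β, hβ, hfβ, φ, hφ, rfl⟩) | hχ)
    · have h1 := hx _ (Or.inl ⟨φ, hφ, rfl⟩)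
      simp only [Formula.realize_relabel] at h1 ⊢
      convert h1 using 1
      ext k
      simp
    · have h1 := hx _ (Or.inr ⟨β, hfβ, φ, hφ, rfl⟩)
      simp only [Formula.realize_relabel, hinst] at h1 ⊢
      rw [hupd β hβ.le ((hfα β).1 hfβ).1, Function.update_of_ne]
      · exact h1
      · simpa using hβ.ne
    · obtain ⟨φ, hφ, rfl⟩ := Finset.mem_image.1 hχ
      simp only [Formula.realize_relabel, hinst]
      rw [hupd α le_rfl hα, Function.update_self]
      exact ha φ hφ
  refine ⟨Sum.inr α, fun φ hφ => ?_⟩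
  have h1 := hx _ (Or.inr ⟨α, hacc, φ, hφ, rfl⟩)
  rwa [Formula.realize_relabel, hinst] at h1

end Saturated

/-! ### Realizing types in many variables in the monster model -/

section Universal

variable {L : FirstOrder.Language.{u, v}}

theorem realize_congr_freeVarFinset {V M : Type*} [L.Structure M] [DecidableEq V]
    (φ : L.Formula V) {x y : V → M} (h : ∀ a ∈ φ.freeVarFinset, x a = y a) :
    φ.Realize x ↔ φ.Realize y :=
  (BoundedFormula.realize_restrictFreeVar (f := id) (v := fun a => x a) x fun _ => rfl).symm.trans
    (BoundedFormula.realize_restrictFreeVar y fun a => h a a.2)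

theorem realize_exClosure_iff {V M : Type*} [L.Structure M] [Nonempty M] [DecidableEq V]
    (φ : L.Formula V) : M ⊨ φ.exClosure ↔ ∃ x : V → M, φ.Realize x := by
  rw [Formula.realize_exClosure]
  constructor
  · rintro ⟨z, hz⟩
    let x : V → M := fun a => if ha : a ∈ φ.freeVarFinset then z ⟨a, ha⟩ else
      Classical.arbitrary M
    exact ⟨x, (BoundedFormula.realize_restrictFreeVar x fun a => by simp [x]).1 hz⟩
  · rintro ⟨x, hx⟩
    exact ⟨fun a => x a, (BoundedFormula.realize_restrictFreeVar (f := id)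
      (v := fun a : φ.freeVarFinset => x a) x fun _ => rfl).2 hx⟩

/-- The existence of a tuple satisfying `σ` with prescribed values on `U` and at `i` is expressed by a
formula, in which the value at `i` is a variable and the values on `U` are parameters. -/
theorem exists_formula_extends {V M : Type*} [L.Structure M] [Nonempty M] (σ : L.Formula V)
    (U : Set V) (i : V) (hi : i ∉ U) (f : V → M) :
    ∃ θ : L.Formula ((f '' U : Set M) ⊕ Fin 1), ∀ c : M,
      θ.Realize (Sum.elim (fun a => (a : M)) fun _ => c) ↔
        ∃ x : V → M, (∀ j ∈ U, x j = f j) ∧ x i = c ∧ σ.Realize x := by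
  classical
  let r : σ.freeVarFinset → ((f '' U : Set M) ⊕ Fin 1) ⊕ σ.freeVarFinset := fun j =>
    if hj : (j : V) ∈ U then Sum.inl (Sum.inl ⟨f j, Set.mem_image_of_mem f hj⟩)
    else if (j : V) = i then Sum.inl (Sum.inr 0) else Sum.inr j
  let θ' : L.Formula (((f '' U : Set M) ⊕ Fin 1) ⊕ σ.freeVarFinset) := σ.restrictFreeVar r
  refine ⟨θ'.iExs σ.freeVarFinset, fun c => ?_⟩
  rw [Formula.realize_iExs]
  constructor
  · rintro ⟨z, hz⟩
    let x : V → M := fun j => if j ∈ U then f j else if j = i then c else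
      if hj : j ∈ σ.freeVarFinset then z ⟨j, hj⟩ else c
    refine ⟨x, fun j hj => by simp [x, hj], by simp [x, hi], ?_⟩
    refine (BoundedFormula.realize_restrictFreeVar (f := r) x fun j => ?_).1 hz
    by_cases hj : (j : V) ∈ U
    · simp [r, x, hj]
    · by_cases hji : (j : V) = i <;> simp [r, x, hj, hji]
      simp [hi]
  · rintro ⟨x, hx, rfl, hσ⟩
    refine ⟨fun j => x j, (BoundedFormula.realize_restrictFreeVar (f := r) x fun j => ?_).2 hσ⟩
    by_cases hj : (j : V) ∈ U
    · simp [r, hj, hx]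
    · by_cases hji : (j : V) = i <;> simp [r, hj, hji]
      simp [hi]

/-- In a saturated structure, every finitely satisfiable set of formulas in few variables is
realized. -/
theorem IsSaturated.exists_realize {C : Type w} [L.Structure C] [Nonempty C] {μ : Cardinal.{w}}
    (hC : IsSaturated L C μ) {V : Type w} (hV : #V < μ) (S : Set (L.Formula V))
    (hS : ∀ s : Finset (L.Formula V), (s : Set (L.Formula V)) ⊆ S →
      ∃ x : V → C, ∀ φ ∈ s, φ.Realize x) :
    ∃ x : V → C, ∀ φ ∈ S, φ.Realize x := by
  classical
  obtain ⟨_, _⟩ := exists_wellFoundedLT V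
  -- `Good U f`: the values of `f` on `U` are compatible with `S`.
  let Good : Set V → (V → C) → Prop := fun U f => ∀ s : Finset (L.Formula V),
    (s : Set (L.Formula V)) ⊆ S → ∃ x : V → C, (∀ j ∈ U, x j = f j) ∧ ∀ φ ∈ s, φ.Realize x
  let R : V → (V → C) → C → Prop := fun i f c => Good (Set.Iio i) f →
    ∀ s : Finset (L.Formula V), (s : Set (L.Formula V)) ⊆ S →
      ∃ x : V → C, (∀ j ∈ Set.Iio i, x j = f j) ∧ x i = c ∧ ∀ φ ∈ s, φ.Realize x
  have hR : ∀ i f, ∃ c, R i f c := by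
    intro i f
    by_cases hgood : Good (Set.Iio i) f
    swap
    · exact ⟨Classical.arbitrary C, fun h => absurd h hgood⟩
    choose θ hθ using fun s : Finset (L.Formula V) =>
      exists_formula_extends (Formula.iInf fun φ : s => (φ : L.Formula V)) (Set.Iio i) i
        (lt_irrefl i) f
    have hθ' : ∀ s c, (θ s).Realize (Sum.elim (fun a => (a : C)) fun _ => c) ↔
        ∃ x : V → C, (∀ j ∈ Set.Iio i, x j = f j) ∧ x i = c ∧ ∀ φ ∈ s, φ.Realize x := by
      intro s c
      simp only [hθ, Formula.realize_iInf, Subtype.forall]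
    obtain ⟨c, hc⟩ := hC (f '' Set.Iio i) (mk_image_le.trans_lt ((mk_set_le _).trans_lt hV))
      ((fun s => (paramEquiv _ (Fin 1)).symm (θ s)) ''
        {s : Finset (L.Formula V) | (s : Set (L.Formula V)) ⊆ S}) (by
      intro t ht
      obtain ⟨t', ht', rfl⟩ := Finset.subset_set_image_iff.1 ht
      obtain ⟨x, hx, hx'⟩ := hgood (t'.biUnion id) (by
        intro φ hφ
        obtain ⟨s, hs, hφs⟩ := Finset.mem_biUnion.1 (Finset.mem_coe.1 hφ)
        exact ht' hs hφs)
      refine ⟨fun _ => x i, fun φ hφ => ?_⟩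
      obtain ⟨s, hs, rfl⟩ := Finset.mem_image.1 hφ
      rw [← realize_paramEquiv, Equiv.apply_symm_apply, hθ']
      exact ⟨x, hx, rfl, fun φ hφ => hx' φ (Finset.mem_biUnion.2 ⟨s, hs, hφ⟩)⟩)
    refine ⟨c 0, fun _ s hs => ?_⟩
    have h1 := hc _ ⟨s, hs, rfl⟩
    rw [← realize_paramEquiv, Equiv.apply_symm_apply] at h1
    rw [← hθ']
    convert h1 using 3 with k
    exact congrArg c (Subsingleton.elim _ _)
  obtain ⟨f, hf⟩ := exists_wellFounded_choice R hR
  have hstep : ∀ i, Good (Set.Iio i) f → ∀ s : Finset (L.Formula V),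
      (s : Set (L.Formula V)) ⊆ S →
      ∃ x : V → C, (∀ j ≤ i, x j = f j) ∧ ∀ φ ∈ s, φ.Realize x := by
    intro i hi s hs
    obtain ⟨f', hf', h1⟩ := hf i
    obtain ⟨x, hx, hxi, hxs⟩ := h1 (fun s hs => by
      obtain ⟨x, hx, hx'⟩ := hi s hs
      exact ⟨x, fun j hj => (hx j hj).trans (hf' j hj).symm, hx'⟩) s hs
    refine ⟨x, fun j hj => ?_, hxs⟩
    rcases hj.lt_or_eq with hlt | rfl
    · exact (hx j hlt).trans (hf' j hlt)
    · exact hxi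
  -- Only the finitely many variables occurring in `s` matter.
  have hlim : ∀ U : Set V, (∀ i ∈ U, Good (Set.Iio i) f) → Good U f := by
    intro U hU s hs
    have hmod : ∀ x : V → C, (∀ φ ∈ s, φ.Realize x) →
        (∀ j ∈ (s.biUnion fun φ => φ.freeVarFinset), j ∈ U → x j = f j) →
        ∃ x : V → C, (∀ j ∈ U, x j = f j) ∧ ∀ φ ∈ s, φ.Realize x := by
      intro x hx hxU
      refine ⟨fun j => if j ∈ U then f j else x j, fun j hj => by simp [hj], fun φ hφ => ?_⟩
      refine (realize_congr_freeVarFinset φ fun j hj => ?_).2 (hx φ hφ)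
      by_cases hjU : j ∈ U
      · simp [hjU, hxU j (Finset.mem_biUnion.2 ⟨φ, hφ, hj⟩) hjU]
      · simp [hjU]
    rcases ((s.biUnion fun φ => φ.freeVarFinset).filter (· ∈ U)).eq_empty_or_nonempty with h0 | h0
    · obtain ⟨x, hx⟩ := hS s hs
      refine hmod x hx fun j hj hjU => ?_
      exact absurd (Finset.mem_filter.2 ⟨hj, hjU⟩) (by simp [h0])
    · obtain ⟨i, hi, hmax⟩ := Finset.exists_max_image _ id h0
      obtain ⟨x, hx, hxs⟩ := hstep i (hU i (Finset.mem_filter.1 hi).2) s hs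
      exact hmod x hxs fun j hj hjU => hx j (hmax j (Finset.mem_filter.2 ⟨hj, hjU⟩))
  have hgood : ∀ i, Good (Set.Iio i) f := fun i => by
    induction i using WellFoundedLT.induction with
    | ind i ih => exact hlim _ ih
  refine ⟨f, fun φ hφ => ?_⟩
  obtain ⟨x, hx, hx'⟩ := hlim Set.univ (fun i _ => hgood i) {φ} (by simpa using hφ)
  have : x = f := funext fun j => hx j trivial
  exact this ▸ hx' φ (Finset.mem_singleton_self φ)

end Universal

/-! ### Saturated pairs -/

section SaturatedPair

variable {L : FirstOrder.Language.{u, v}} {C : Type w} [L.Structure C] {μ κ : Cardinal.{w}}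

theorem realize_predFormula_iff {V M : Type*} [(pairLang L).Structure M] (i : V) (x : V → M) :
    (predFormula (L := L) i).Realize x ↔
      Structure.RelMap (L := pairLang L) (Sum.inr PredRel.P) ![x i] := by
  rw [predFormula, Formula.realize_rel₁]
  rfl

theorem SmallPair.realize_predFormula {V : Type*} (N : SmallPair L C μ) (i : V) (x : V → N.M) :
    (predFormula (L := L) i).Realize x ↔ (x i : C) ∈ N.P := by
  rw [realize_predFormula_iff]
  rfl

theorem SmallPair.realize_onFormula {V : Type*} (N : SmallPair L C μ) (φ : L.Formula V)
    (x : V → N.M) : ((LHom.sumInl : L →ᴸ pairLang L).onFormula φ).Realize x ↔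
      φ.Realize fun i => (x i : C) := by
  rw [LHom.realize_onFormula]
  exact (N.M.subtype.map_formula φ x).symm

theorem SmallPair.small_pred (N : SmallPair L C μ) : #N.P < μ :=
  (mk_le_mk_of_subset N.subset).trans_lt N.small

theorem SmallPair.models_pairTheory (N : SmallPair L C μ) : N.Models (pairTheory L C) :=
  (LHom.onTheory_model (LHom.sumInl : L →ᴸ pairLang L) (L.completeTheory C)).2
    (N.M.theory_model_iff _ |>.2 inferInstance)

theorem card_pairLang_le (hκ : ℵ₀ ≤ κ)
    (hL : Cardinal.lift.{w} L.card ≤ Cardinal.lift.{max u v} κ) :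
    Cardinal.lift.{w} (pairLang L).card ≤ Cardinal.lift.{max u v} κ := by
  have h1 : ∀ n, Countable (predLang.Relations n) := fun n => by
    have : Subsingleton (PredRel n) := ⟨fun a b => by cases a; cases b; rfl⟩
    exact inferInstanceAs (Countable (PredRel n))
  have h2 : ∀ n, Countable (predLang.Functions n) := fun n =>
    inferInstanceAs (Countable Empty)
  have h3 : predLang.card ≤ ℵ₀ := by
    have : Countable predLang.Symbols := inferInstanceAs
      (Countable ((Σ l, predLang.Functions l) ⊕ Σ l, predLang.Relations l))
    exact mk_le_aleph0
  have hκ' : ℵ₀ ≤ Cardinal.lift.{max u v} κ := by simpa using hκ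
  rw [card_sum, lift_add, lift_lift, lift_lift]
  refine add_le_of_le hκ' ?_ ?_
  · simpa using hL
  · exact (lift_le_aleph0.2 h3).trans hκ'

/-- Every set of formulas consistent with an expansion of `pairTheory L C` is realized in a
`κ`-saturated small pair. -/
theorem exists_saturated_smallPair [Nonempty C] (hC : IsMonster L C μ) (hκ : ℵ₀ ≤ κ)
    (hL : Cardinal.lift.{w} L.card ≤ Cardinal.lift.{max u v} κ) (hκμ : κ < μ)
    {T : (pairLang L).Theory} (hT : pairTheory L C ⊆ T) {V : Type w} (hV : #V ≤ 2 ^ κ)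
    {S : Set ((pairLang L).Formula V)} (hS : Consistent T S) :
    ∃ N : SmallPair L C μ, N.Models T ∧ IsSaturated (pairLang L) N.M κ ∧
      ∃ y : V → N.M, ∀ φ ∈ S, φ.Realize y := by
  classical
  have hμ : ℵ₀ ≤ μ := hC.isStrongLimit.aleph0_le
  have hθ : (2 : Cardinal.{w}) ^ κ < μ := hC.isStrongLimit.isStrongPrelimit hκμ
  obtain ⟨N₀, x, hx, htask⟩ :=
    exists_model_realizing_tasks hκ (card_pairLang_le hκ hL) hV hS
  have hV' : #(V ⊕ Stage κ) < μ := by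
    rw [mk_sum, lift_id, lift_id]
    exact add_lt_of_lt hμ (hV.trans_lt hθ) ((Stage.mk κ).trans_lt hθ)
  let : L.Structure N₀ := (LHom.sumInl : L →ᴸ pairLang L).reduct N₀
  have : (LHom.sumInl : L →ᴸ pairLang L).IsExpansionOn N₀ := LHom.isExpansionOn_reduct _ _
  have hN₀ : N₀ ⊨ L.completeTheory C :=
    (LHom.onTheory_model (LHom.sumInl : L →ᴸ pairLang L) _).1 (N₀.is_model.mono hT)
  have hfrom : ∀ φ : (pairLang L).Formula ((V ⊕ Stage κ) ⊕ Fin 1),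
      (∃ a, φ.Realize (Sum.elim x fun _ => a)) → ∃ i, φ.Realize (Sum.elim x fun _ => x i) :=
    exists_realize_of_tasks hκ x fun t ⟨a, ha⟩ => htask t fun s hs => ⟨a, fun φ hφ => ha φ (hs hφ)⟩
  -- The reduct to `L` of the model enumerated by `x` is copied into the monster model.
  obtain ⟨h, hh⟩ := hC.isSaturated.exists_realize hV' {φ : L.Formula (V ⊕ Stage κ) | φ.Realize x}
    (by
      intro s hs
      let σ : L.Formula (V ⊕ Stage κ) := Formula.iInf fun φ : s => (φ : L.Formula (V ⊕ Stage κ))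
      have hσ : σ.Realize x := by
        rw [Formula.realize_iInf]
        exact fun φ => hs φ.2
      have h1 : N₀ ⊨ σ.exClosure := (realize_exClosure_iff σ).2 ⟨x, hσ⟩
      have h2 : C ⊨ σ.exClosure := by
        by_contra hcon
        exact hN₀.realize_of_mem σ.exClosure.not hcon h1
      obtain ⟨z, hz⟩ := (realize_exClosure_iff σ).1 h2
      rw [Formula.realize_iInf] at hz
      exact ⟨z, fun φ hφ => hz ⟨φ, hφ⟩⟩)
  have hiff : ∀ φ : L.Formula (V ⊕ Stage κ), φ.Realize h ↔ φ.Realize x := fun φ => by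
    refine ⟨fun h1 => ?_, hh φ⟩
    by_contra h2
    exact hh φ.not h2 h1
  have heq : ∀ i j, h i = h j ↔ x i = x j := fun i j => by
    simpa using hiff (Term.equal (Term.var i) (Term.var j))
  obtain ⟨M, hM⟩ := exists_elementarySubstructure (L := L) h (fun φ hφ => by
    obtain ⟨a, ha⟩ := hφ
    have h1 : (φ.iExs (Fin 1)).Realize x := by
      rw [← hiff, Formula.realize_iExs]
      exact ⟨fun _ => a, ha⟩
    rw [Formula.realize_iExs] at h1
    obtain ⟨a', ha'⟩ := h1
    obtain ⟨i, hi⟩ := hfrom ((LHom.sumInl : L →ᴸ pairLang L).onFormula φ) ⟨a' 0, by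
      rw [LHom.realize_onFormula]
      convert ha' with k⟩
    rw [LHom.realize_onFormula] at hi
    have h2 := (hiff (φ.relabel (Sum.elim id fun _ => i))).2 (by
      rw [Formula.realize_relabel]
      convert hi using 1
      ext (_ | _) <;> rfl)
    rw [Formula.realize_relabel] at h2
    refine ⟨i, ?_⟩
    convert h2 using 1
    ext (_ | _) <;> rfl)
  have hmem : ∀ i, h i ∈ M := fun i => by
    change h i ∈ (M : Set C)
    exact hM ▸ Set.mem_range_self i
  obtain ⟨N, rfl, hNP⟩ : ∃ N : SmallPair L C μ, N.M = M ∧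
      ∀ c, c ∈ N.P ↔ ∃ i, h i = c ∧ (predFormula (L := L) i).Realize x :=
    ⟨{ M := M
       P := {c | ∃ i, h i = c ∧ (predFormula (L := L) i).Realize x}
       small := (congrArg (fun s : Set C => #s) hM).trans_lt (mk_range_le.trans_lt hV')
       subset := by
        rintro _ ⟨i, rfl, -⟩
        exact hmem i }, rfl, fun _ => Iff.rfl⟩
  let y : V ⊕ Stage κ → N.M := fun i => ⟨h i, hmem i⟩
  have hy : ∀ z : N.M, ∃ i, y i = z := fun z => by
    have hz : (z : C) ∈ (N.M : Set C) := z.2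
    rw [hM] at hz
    obtain ⟨i, hi⟩ := hz
    exact ⟨i, Subtype.ext hi⟩
  choose idx hidx using hy
  have hyx : ∀ i j, y i = y j ↔ x i = x j := fun i j => by
    rw [← heq]
    exact Subtype.ext_iff
  have hidx' : ∀ i, x (idx (y i)) = x i := fun i => (hyx _ _).1 (hidx _)
  -- The pair embeds into the model, by the Tarski–Vaught test elementarily.
  let e : N.M ↪[pairLang L] N₀ :=
    { toFun := fun z => x (idx z)
      inj' := fun z z' hz => by
        rw [← hidx z, ← hidx z']
        exact (hyx _ _).2 hz
      map_fun' := by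
        rintro n (f | f) z
        · have h1 := hiff (Term.equal (Term.func f fun k => Term.var (idx (z k)))
            (Term.var (idx (Structure.funMap (L := pairLang L) (Sum.inl f) z))))
          simp only [Formula.realize_equal, Term.realize_func, Term.realize_var] at h1
          refine (h1.1 ?_).symm
          have h2 := congrArg Subtype.val (hidx (Structure.funMap (L := pairLang L) (Sum.inl f) z))
          refine Eq.trans ?_ h2.symm
          have h3 := N.M.subtype.map_fun f z
          refine Eq.trans (congrArg _ ?_) h3.symm
          ext k
          exact congrArg Subtype.val (hidx (z k))
        · exact f.elim
      map_rel' := by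
        rintro n (r | r) z
        · have h1 := hiff (Relations.formula r fun k => Term.var (idx (z k)))
          simp only [Formula.realize_rel, Term.realize_var] at h1
          refine h1.symm.trans ?_
          have h3 := N.M.subtype.map_rel r z
          refine Iff.trans (iff_of_eq (congrArg _ ?_)) h3
          ext k
          exact congrArg Subtype.val (hidx (z k))
        · cases r
          have h1 := realize_predFormula_iff (L := L) (idx (z 0)) x
          have h2 : (fun k => x (idx (z k))) = ![x (idx (z 0))] := by
            ext k
            rw [Subsingleton.elim k 0]
            rfl
          refine (iff_of_eq (congrArg _ h2)).trans (h1.symm.trans ?_)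
          refine Iff.trans ?_ (hNP _).symm
          constructor
          · exact fun h3 => ⟨idx (z 0), congrArg Subtype.val (hidx (z 0)), h3⟩
          · rintro ⟨i, hi, h3⟩
            rw [realize_predFormula_iff] at h3 ⊢
            have : x i = x (idx (z 0)) := (heq _ _).1 (hi.trans
              (congrArg Subtype.val (hidx (z 0))).symm)
            rwa [← this] }
  have he : ∀ z, e z = x (idx z) := fun z => rfl
  let e' : N.M ↪ₑ[pairLang L] N₀ := e.toElementaryEmbedding (by
    intro n φ z a ha
    let ψ : (pairLang L).Formula ((V ⊕ Stage κ) ⊕ Fin 1) :=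
      φ.toFormula.relabel (Sum.elim Empty.elim
        (Fin.snoc (α := fun _ => (V ⊕ Stage κ) ⊕ Fin 1) (fun k => Sum.inl (idx (z k)))
          (Sum.inr 0)))
    have hψ : ∀ b, ψ.Realize (Sum.elim x fun _ => b) ↔
        φ.Realize default (Fin.snoc (e ∘ z) b : _ → N₀) := fun b => by
      rw [Formula.realize_relabel, BoundedFormula.realize_toFormula]
      refine iff_of_eq (congrArg₂ _ (Subsingleton.elim _ _) ?_)
      ext k
      refine Fin.lastCases ?_ (fun k => ?_) k
      · simp
      · simp [he]
    obtain ⟨i, hi⟩ := hfrom ψ ⟨a, (hψ a).2 ha⟩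
    refine ⟨y i, ?_⟩
    rw [he, hidx']
    exact (hψ _).1 hi)
  have he' : ∀ z, e' z = x (idx z) := fun z => rfl
  refine ⟨N, ?_, ?_, fun i => y (Sum.inl i), fun φ hφ => ?_⟩
  · exact (e'.theory_model_iff T).2 N₀.is_model
  · intro A hA p hp
    obtain ⟨j⟩ : Nonempty (A ↪ κ.out) := by
      rw [← Cardinal.le_def, Cardinal.mk_out]
      exact hA.le
    have hreal : ∀ (ψ : (pairLang L)[[A]].Formula (Fin 1)) (z : Fin 1 → N.M),
        (paramEquiv A (Fin 1) ψ).Realize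
          (Sum.elim (x ∘ fun a : A => idx a) fun _ => e' (z 0)) ↔ ψ.Realize z := fun ψ z => by
      rw [← realize_paramEquiv, ← e'.map_formula]
      refine iff_of_eq (congrArg _ ?_)
      ext (a | k)
      · rfl
      · rw [Subsingleton.elim k 0]
        rfl
    let t (q : Set ((pairLang L)[[A]].Formula (Fin 1))) : Task (pairLang L) κ (V ⊕ Stage κ) :=
      Task.ofTuple j (fun a : A => idx a) (paramEquiv A (Fin 1) '' q)
    have ht : ∀ q (z : Fin 1 → N.M), (t q).Realizes x (e' (z 0)) ↔ ∀ ψ ∈ q, ψ.Realize z :=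
      fun q z => by
        simp only [t, Task.realizes_ofTuple, Set.forall_mem_image, hreal]
    obtain ⟨i, hi⟩ := htask (t p) (by
      intro s hs
      obtain ⟨s', hs', rfl⟩ := Finset.subset_set_image_iff.1 hs
      obtain ⟨s'', hs'', rfl⟩ := Finset.subset_set_image_iff.1 hs'
      obtain ⟨z, hz⟩ := hp s'' hs''
      refine ⟨e' (z 0), fun φ hφ => ?_⟩
      have h1 := (ht s'' z).2 hz
      obtain ⟨χ, hχ, rfl⟩ := Finset.mem_image.1 hφ
      obtain ⟨ψ, hψ, rfl⟩ := Finset.mem_image.1 hχ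
      exact h1 _ ⟨_, ⟨ψ, hψ, rfl⟩, rfl⟩)
    refine ⟨fun _ => y i, (ht p _).1 ?_⟩
    rwa [he', hidx']
  · rw [← e'.map_formula]
    convert hx φ hφ using 1
    ext i
    exact hidx' _

end SaturatedPair

/-! ### Consequences of the Density property -/

section Density

variable {L : FirstOrder.Language.{u, v}} {C : Type w} [L.Structure C] [Nonempty C]
  {μ κ lam : Cardinal.{w}} {Ind : Set C → Set C → Set C → Prop}

/-- The Density property for types in several variables: a finite tuple which is independent from a
very small `A ⊆ M` over some `B ⊆ P(A)` has a conjugate over `A` in the predicate. -/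
theorem DensityProperty.exists_conjugate (hC : IsMonster L C μ)
    (hInd : IsIndependenceRelation L μ Ind) (hlam : ℵ₀ ≤ lam) (hlamμ : lam ≤ μ)
    {N : SmallPair L C μ} (hN : DensityProperty lam Ind N) {n : ℕ} (a : Fin n → C) {A B : Set C}
    (hAM : A ⊆ N.M) (hA : #A < lam) (hBP : B ⊆ N.P) (hBA : B ⊆ A) (ha : Ind (Set.range a) B A) :
    ∃ σ : C ≃[L] C, (∀ x ∈ A, σ x = x) ∧ ∀ i, σ (a i) ∈ N.P := by
  have hμ : ℵ₀ ≤ μ := hC.isStrongLimit.aleph0_le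
  induction n generalizing A B with
  | zero => exact ⟨FirstOrder.Language.Equiv.refl L C, fun x _ => rfl, fun i => i.elim0⟩
  | succ n ih =>
    have hAμ := hA.trans_le hlamμ
    have hBμ := (mk_le_mk_of_subset hBA).trans_lt hAμ
    have hone : ∀ x : C, #({x} : Set C) < lam := fun x => by
      simpa using one_lt_aleph0.trans_le hlam
    have hfin : ∀ {s : Set C}, s.Finite → #s < μ := fun hs => hs.lt_aleph0.trans_le hμ
    have h0 : Ind {a 0} B A := hInd.mono_left (hfin (Set.finite_range a)) hBμ hAμ
      (Set.singleton_subset_iff.2 ⟨0, rfl⟩) ha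
    have h1 : Ind {a 0} (N.P ∩ A) A := hInd.base_mono ((hone _).trans_le hlamμ) hAμ
      (Set.subset_inter hBP hBA) Set.inter_subset_right h0
    obtain ⟨c, hcP, hc⟩ := hN A hAM hA _ ⟨a 0, rfl, h1⟩
    obtain ⟨σ, hσ, rfl⟩ := hC.exists_equiv_of_typeOver_eq hAμ hc.symm
    have h2 : Ind (Set.range (σ ∘ a)) B A := by
      have := hInd.invariance σ _ _ _ (hfin (Set.finite_range a)) hBμ hAμ ha
      rwa [← Set.range_comp, Set.image_congr fun x hx => hσ x (hBA hx), Set.image_congr hσ,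
        Set.image_id', Set.image_id'] at this
    have hlt : #({σ (a 0)} ∪ A : Set C) < lam :=
      (mk_union_le _ _).trans_lt (add_lt_of_lt hlam (hone _) hA)
    have hrange := hfin (Set.finite_range (σ ∘ a))
    have h3 : Ind A B (Set.range (σ ∘ a) ∪ B) :=
      hInd.union_base hμ hAμ hBμ hrange (hInd.symmetry _ _ _ hrange hBμ hAμ h2)
    have hsub : {σ (a 0)} ∪ B ⊆ Set.range (σ ∘ a) ∪ B :=
      Set.union_subset_union_left _ (Set.singleton_subset_iff.2 ⟨0, rfl⟩)
    have hRB := IsIndependenceRelation.mk_union_lt hμ hrange hBμ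
    have hcB := (mk_le_mk_of_subset hsub).trans_lt hRB
    have hsub' : Set.range (fun i : Fin n => σ (a i.succ)) ⊆ Set.range (σ ∘ a) := by
      rintro _ ⟨i, rfl⟩
      exact ⟨i.succ, rfl⟩
    have h4 : Ind (Set.range fun i : Fin n => σ (a i.succ)) ({σ (a 0)} ∪ B) A :=
      hInd.symmetry _ _ _ hAμ hcB (hfin (Set.finite_range _))
        (hInd.mono_right hAμ hcB hRB (hsub'.trans Set.subset_union_left)
          (hInd.base_mono hAμ hRB Set.subset_union_right hsub h3))
    have h5 := hInd.union_base hμ (hfin (Set.finite_range _)) hcB hAμ h4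
    have h6 : A ∪ ({σ (a 0)} ∪ B) = {σ (a 0)} ∪ A := by
      rw [Set.union_left_comm, Set.union_eq_left.2 hBA]
    rw [h6] at h5
    obtain ⟨τ, hτ, hτP⟩ := ih (fun i : Fin n => σ (a i.succ))
      (Set.union_subset (Set.singleton_subset_iff.2 (N.subset hcP)) hAM) hlt
      (Set.union_subset (Set.singleton_subset_iff.2 hcP) hBP)
      (Set.union_subset_union_right _ hBA) h5
    refine ⟨τ.comp σ, fun x hx => ?_, fun i => ?_⟩
    · rw [FirstOrder.Language.Equiv.comp_apply, hσ x hx]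
      exact hτ x (Or.inr hx)
    · rw [FirstOrder.Language.Equiv.comp_apply]
      refine Fin.cases ?_ (fun i => ?_) i
      · rw [hτ _ (Or.inl rfl)]
        exact hcP
      · exact hτP i

/-- If `φ(x̄, b̄)` does not fork over `c̄ ∈ P` and the Density property holds, then `φ(x̄, b̄)` is
realized in the predicate. -/
theorem DensityProperty.exists_realize (hC : IsMonster L C μ)
    (hInd : IsIndependenceRelation L μ Ind) (hlam : ℵ₀ ≤ lam) (hlamμ : lam ≤ μ)
    {N : SmallPair L C μ} (hN : DensityProperty lam Ind N) {n m : ℕ} {ι : Type w} (hι : #ι < lam)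
    (φ : L.Formula (Fin n ⊕ Fin m)) {b : Fin m → C} {c : ι → C} (hb : ∀ i, b i ∈ N.M)
    (hc : ∀ i, c i ∈ N.P) (h : NotForks L Ind φ b c) :
    ∃ a : Fin n → C, (∀ i, a i ∈ N.P) ∧ φ.Realize (Sum.elim a b) := by
  have hμ : ℵ₀ ≤ μ := hC.isStrongLimit.aleph0_le
  obtain ⟨a, ha, hi⟩ := h
  have hfin : ∀ {s : Set C}, s.Finite → #s < lam := fun hs => hs.lt_aleph0.trans_le hlam
  have hcl : #(Set.range c) < lam := mk_range_le.trans_lt hι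
  obtain ⟨σ, hσ, hσP⟩ := hN.exists_conjugate hC hInd hlam hlamμ a
    (A := Set.range b ∪ Set.range c) (B := Set.range c)
    (Set.union_subset (Set.range_subset_iff.2 hb)
      (Set.range_subset_iff.2 fun i => N.subset (hc i)))
    ((mk_union_le _ _).trans_lt (add_lt_of_lt hlam (hfin (Set.finite_range b)) hcl))
    (Set.range_subset_iff.2 hc) Set.subset_union_right
    (hInd.union_base hμ ((hfin (Set.finite_range a)).trans_le hlamμ) (hcl.trans_le hlamμ)
      ((hfin (Set.finite_range b)).trans_le hlamμ) hi)
  refine ⟨fun i => σ (a i), hσP, ?_⟩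
  rw [← StrongHomClass.realize_formula σ] at ha
  convert ha using 1
  ext (i | i)
  · rfl
  · exact (hσ _ (Or.inl ⟨i, rfl⟩)).symm

theorem DensityProperty.densityCondition (hC : IsMonster L C μ)
    (hInd : IsIndependenceRelation L μ Ind) (hlam : ℵ₀ ≤ lam) (hlamμ : lam ≤ μ)
    {N : SmallPair L C μ} (hN : DensityProperty lam Ind N) : DensityCondition lam Ind N := by
  intro m φ ι hι b c hc h
  obtain ⟨a, haP, ha⟩ := hN.exists_realize hC hInd hlam hlamμ hι φ (fun i => (b i).2) hc
    (not_not.1 h)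
  refine ⟨⟨a 0, N.subset (haP 0)⟩, haP 0, ?_⟩
  rw [← N.M.subtype.map_formula]
  convert ha using 1
  ext (i | i)
  · rw [Subsingleton.elim i 0]
    rfl
  · rfl

/-- In a `κ`-saturated pair, the condition on formulas `φ(x, b̄)` yields the Density property. -/
theorem DensityCondition.densityProperty (hInd : IsIndependenceRelation L μ Ind)
    (hμ : ℵ₀ ≤ μ) (hlamκ : lam ≤ κ) (hlamμ : lam ≤ μ)
    {N : SmallPair L C μ} (hN : DensityCondition lam Ind N)
    (hsat : IsSaturated (pairLang L) N.M κ) : DensityProperty lam Ind N := by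
  classical
  rintro A hAM hA q ⟨a, rfl, ha⟩
  have hAμ : #A < μ := hA.trans_le hlamμ
  have hPA : #(N.P ∩ A : Set C) < lam := (mk_le_mk_of_subset Set.inter_subset_right).trans_lt hA
  let A' : Set N.M := {z | (z : C) ∈ A}
  let g : A → A' := fun z => ⟨⟨z, hAM z.2⟩, z.2⟩
  have hA' : #A' < κ := by
    have : Function.Injective fun z : A' => (⟨z, z.2⟩ : A) := fun z z' h =>
      Subtype.ext (Subtype.ext (congrArg (fun t : A => (t : C)) h))
    exact (mk_le_of_injective this).trans_lt (hA.trans_le hlamκ)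
  -- The formula `P(x) ∧ φ(x)`, with its parameters from `A` regarded as elements of the pair.
  let tr : L.Formula (A ⊕ Fin 1) → (pairLang L)[[A']].Formula (Fin 1) := fun φ =>
    (paramEquiv A' (Fin 1)).symm (predFormula (Sum.inr 0) ⊓
      (LHom.sumInl.onFormula φ).relabel (Sum.map g id))
  have htr : ∀ φ (z : Fin 1 → N.M), (tr φ).Realize z ↔
      (z 0 : C) ∈ N.P ∧ φ.Realize (Sum.elim (fun y => (y : C)) fun _ => (z 0 : C)) := by
    intro φ z
    rw [← realize_paramEquiv, Equiv.apply_symm_apply, Formula.realize_inf,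
      N.realize_predFormula, Formula.realize_relabel, N.realize_onFormula]
    refine and_congr Iff.rfl (iff_of_eq (congrArg _ (funext ?_)))
    rintro (y | k)
    · rfl
    · rw [Subsingleton.elim k 0]
      rfl
  obtain ⟨z, hz⟩ := hsat A' hA' (tr '' {φ | φ.Realize (Sum.elim (fun y => (y : C)) fun _ => a)})
    (by
      intro s hs
      obtain ⟨s', hs', rfl⟩ := Finset.subset_set_image_iff.1 hs
      obtain ⟨m, b, φ, hφ⟩ := exists_finite_variables
        (Formula.iInf fun φ : s' => (φ : L.Formula (A ⊕ Fin 1)))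
      have hb : Set.range (fun i => (b i : C)) ⊆ A := Set.range_subset_iff.2 fun i => (b i).2
      obtain ⟨d, hdP, hd⟩ := hN m φ (N.P ∩ A : Set C) hPA (fun i => ⟨b i, hAM (b i).2⟩)
        (fun i => ⟨i, hAM i.2.2⟩) (fun i => i.2.1) (not_not.2 ⟨fun _ => a, by
          have h1 := (hφ C (fun y => (y : C)) fun _ => a).2
          refine h1 ?_
          rw [Formula.realize_iInf]
          exact fun ψ => hs' ψ.2, by
          rw [Set.range_const]
          have h1 := hInd.mono_right
            (by simpa using one_lt_aleph0.trans_le hμ) (hPA.trans_le hlamμ) hAμ hb ha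
          convert h1 using 1
          exact Subtype.range_coe⟩)
      refine ⟨fun _ => d, fun χ hχ => ?_⟩
      obtain ⟨ψ, hψ, rfl⟩ := Finset.mem_image.1 hχ
      refine (htr ψ _).2 ⟨hdP, ?_⟩
      have h1 := (hφ C (fun y => (y : C)) fun _ => (d : C)).1 (by
        rw [← N.M.subtype.map_formula] at hd
        convert hd using 1
        ext (_ | _) <;> rfl)
      rw [Formula.realize_iInf] at h1
      exact h1 ⟨ψ, hψ⟩)
  have hz' : ∀ φ : L.Formula (A ⊕ Fin 1),
      φ.Realize (Sum.elim (fun y => (y : C)) fun _ => a) →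
      (z 0 : C) ∈ N.P ∧ φ.Realize (Sum.elim (fun y => (y : C)) fun _ => (z 0 : C)) :=
    fun φ hφ => (htr φ z).1 (hz _ ⟨φ, hφ, rfl⟩)
  refine ⟨z 0, (hz' ⊤ id).1, typeOver_eq_iff.2 fun φ => ⟨fun h1 => ?_, fun h1 => (hz' φ h1).2⟩⟩
  by_contra h2
  exact (hz' φ.not h2).2 h1

/-! ### The axiom scheme -/

open Classical in
theorem SmallPair.realize_densityAxiom (N : SmallPair L C μ) {m : ℕ} {ι : Type w}
    (φ : L.Formula (Fin 1 ⊕ Fin m)) (ψ : L.Formula (Fin m ⊕ ι)) :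
    Sentence.Realize (L := pairLang L) N.M (densityAxiom φ ψ) ↔
      ∀ x : Fin m ⊕ ι → N.M, (∀ j, Sum.inr j ∈ ψ.freeVarFinset → (x (Sum.inr j) : C) ∈ N.P) →
        ¬ ψ.Realize x → ∃ a : N.M, (a : C) ∈ N.P ∧
          φ.Realize (Sum.elim (fun _ => a) (x ∘ Sum.inl)) := by
  have key : ∀ (x : Fin m ⊕ ι → N.M) (a : Fin 1 → N.M),
      Sum.elim x a ∘ Sum.elim Sum.inr (Sum.inl ∘ Sum.inl) =
        Sum.elim (fun _ => a 0) (x ∘ Sum.inl) := fun x a => by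
    ext (k | k)
    · rw [Subsingleton.elim k 0]
      rfl
    · rfl
  unfold densityAxiom
  rw [Sentence.realize_not, realize_exClosure_iff]
  push Not
  refine forall_congr' fun x => ?_
  simp only [Formula.realize_not, not_not, Formula.realize_imp, Formula.realize_iInf,
    Formula.realize_iExs, Formula.realize_inf, N.realize_predFormula, Formula.realize_relabel,
    LHom.realize_onFormula, key, Sum.elim_inr, Subtype.forall, Finset.mem_toRight]
  refine imp_congr Iff.rfl (imp_congr Iff.rfl ⟨fun ⟨a, ha⟩ => ⟨a 0, ha⟩, fun ⟨a, ha⟩ =>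
    ⟨fun _ => a, ha⟩⟩)

/-- The axiom scheme expresses the condition on formulas `φ(x, b̄)` which do not fork. -/
theorem models_densityScheme_iff (hInd : IsIndependenceRelation L μ Ind) (hμ : ℵ₀ ≤ μ)
    (hlam : ℵ₀ ≤ lam)
    {Γ : TypeFamily.{u, v, w} L} (hΓ : DefinesForking lam Ind Γ) (N : SmallPair L C μ) :
    N.Models (densityScheme lam Γ) ↔ DensityCondition lam Ind N := by
  classical
  have hreal : ∀ {V : Type w} (ψ : L.Formula V) (x : V → N.M),
      ψ.Realize (fun i => (x i : C)) ↔ ψ.Realize x := fun ψ x => N.M.subtype.map_formula ψ x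
  constructor
  · intro h m φ ι hι b c hc hbc
    rw [hΓ m φ ι hι] at hbc
    push Not at hbc
    obtain ⟨ψ, hψ, hψbc⟩ := hbc
    have h1 := h.realize_of_mem _ ⟨m, φ, ι, hι, ψ, hψ, rfl⟩
    rw [N.realize_densityAxiom] at h1
    refine h1 (Sum.elim b c) (fun j _ => hc j) fun h2 => hψbc ?_
    rw [← hreal] at h2
    convert h2 using 1
    ext (_ | _) <;> rfl
  · intro h
    refine ⟨?_⟩
    rintro _ ⟨m, φ, ι, hι, ψ, hψ, rfl⟩
    rw [N.realize_densityAxiom]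
    intro x hx hψx
    -- The formula `⊤` does not fork over `∅`, hence the predicate is nonempty, and the variables not
    -- occurring in `ψ` can be interpreted in it.
    obtain ⟨d, hdP, -⟩ := h 0 ⊤ PEmpty (by simpa using aleph0_pos.trans_le hlam)
      (fun i => i.elim0) (fun i => i.elim) (fun i => i.elim) (not_not.2 (by
        have hone : ∀ x : C, #({x} : Set C) < μ := fun x => by
          simpa using one_lt_aleph0.trans_le hμ
        have hzero : #(∅ : Set C) < μ := by simpa using aleph0_pos.trans_le hμ
        refine ⟨fun _ => Classical.arbitrary C, id, ?_⟩
        rw [Set.range_const, Set.range_eq_empty, Set.range_eq_empty]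
        exact hInd.symmetry _ _ _ hzero hzero (hone _) (hInd.base_self hzero (hone _))))
    let c : ι → N.M := fun j => if Sum.inr j ∈ ψ.freeVarFinset then x (Sum.inr j) else d
    refine h m φ ι hι (x ∘ Sum.inl) c (fun j => ?_) ?_
    · by_cases hj : Sum.inr j ∈ ψ.freeVarFinset
      · simpa [c, hj] using hx j hj
      · simpa [c, hj] using hdP
    · rw [hΓ m φ ι hι]
      intro h2
      refine hψx ?_
      rw [← hreal, realize_congr_freeVarFinset ψ]
      · exact h2 ψ hψ
      · rintro (i | j) hj
        · rfl
        · simp [c, hj]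

end Density

/-! ### Lowness -/

section Low

variable {L : FirstOrder.Language.{u, v}} {C : Type w} [L.Structure C]
  {μ κ lam : Cardinal.{w}} {Ind : Set C → Set C → Set C → Prop}

theorem NotForks.map (hInd : IsIndependenceRelation L μ Ind) (hμ : ℵ₀ ≤ μ) {n m : ℕ} {ι : Type w}
    (hι : #ι < μ) {φ : L.Formula (Fin n ⊕ Fin m)} {b : Fin m → C} {c : ι → C} (σ : C ≃[L] C)
    (h : NotForks L Ind φ b c) : NotForks L Ind φ (σ ∘ b) (σ ∘ c) := by
  obtain ⟨a, ha, hi⟩ := h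
  have hfin : ∀ {s : Set C}, s.Finite → #s < μ := fun hs => hs.lt_aleph0.trans_le hμ
  refine ⟨σ ∘ a, ?_, ?_⟩
  · rw [← Sum.comp_elim, StrongHomClass.realize_formula]
    exact ha
  · rw [Set.range_comp, Set.range_comp, Set.range_comp]
    exact hInd.invariance σ _ _ _ (hfin (Set.finite_range a)) (mk_range_le.trans_lt hι)
      (hfin (Set.finite_range b)) hi

/-- The formula `¬ ∃ x̄ ∈ P, φ(x̄, ȳ)`. -/
noncomputable def notRealizedInPred {n m : ℕ} (ι : Type w) (φ : L.Formula (Fin n ⊕ Fin m)) :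
    (pairLang L).Formula (Fin m ⊕ ι) :=
  (Formula.iExs (Fin n) ((Formula.iInf fun k : Fin n => predFormula (Sum.inr k)) ⊓
    (LHom.sumInl.onFormula φ).relabel (Sum.elim Sum.inr (Sum.inl ∘ Sum.inl)))).not

theorem SmallPair.realize_notRealizedInPred (N : SmallPair L C μ) {n m : ℕ} {ι : Type w}
    (φ : L.Formula (Fin n ⊕ Fin m)) (y : Fin m ⊕ ι → N.M) :
    (notRealizedInPred ι φ).Realize y ↔ ¬ ∃ a : Fin n → C, (∀ i, a i ∈ N.P) ∧
      φ.Realize (Sum.elim a fun i => (y (Sum.inl i) : C)) := by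
  have key : ∀ a : Fin n → N.M, (fun i => ((Sum.elim y a ∘
      Sum.elim Sum.inr (Sum.inl ∘ Sum.inl) : Fin n ⊕ Fin m → N.M) i : C)) =
        Sum.elim (fun i => (a i : C)) fun i => (y (Sum.inl i) : C) := fun a => by
    ext (_ | _) <;> rfl
  simp only [notRealizedInPred, Formula.realize_not, Formula.realize_iExs, Formula.realize_inf,
    Formula.realize_iInf, N.realize_predFormula, Formula.realize_relabel, N.realize_onFormula, key,
    Sum.elim_inr]
  exact not_congr ⟨fun ⟨a, ha⟩ => ⟨fun i => a i, ha⟩, fun ⟨a, ha, ha'⟩ =>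
    ⟨fun i => ⟨a i, N.subset (ha i)⟩, ha, ha'⟩⟩

theorem exists_definesForking (h : IsLow L lam Ind) :
    ∃ Γ : TypeFamily.{u, v, w} L, DefinesForking lam Ind Γ := by
  classical
  choose Γ hΓ using h
  exact ⟨fun m φ ι => if hι : #ι < lam then Γ 1 m φ ι hι else ∅, fun m φ ι hι => by
    simpa [hι] using hΓ 1 m φ ι hι⟩

variable [Nonempty C]

/-- If the Density property is first order, then the independence relation is low. -/
theorem isLow_of_isFirstOrderProperty (hC : IsMonster L C μ)
    (hInd : IsIndependenceRelation L μ Ind) (hκ : ℵ₀ ≤ κ)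
    (hL : Cardinal.lift.{w} L.card ≤ Cardinal.lift.{max u v} κ) (hκμ : κ < μ) (hlam : ℵ₀ ≤ lam)
    (hlamκ : lam ≤ κ)
    (h : IsFirstOrderProperty κ (DensityProperty (L := L) (μ := μ) lam Ind)) :
    IsLow L lam Ind := by
  classical
  obtain ⟨T, hT, hmod, hsat⟩ := h
  have hμ : ℵ₀ ≤ μ := hκ.trans hκμ.le
  have hlamμ : lam ≤ μ := hlamκ.trans hκμ.le
  intro n m φ ι hι
  -- `Γ` defines the closure of the forking set; it remains to see that this set is closed.
  refine ⟨{ψ | ∀ b c, (b, c) ∈ ForkingSet L ι Ind φ → ψ.Realize (Sum.elim b c)},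
    fun b₀ c₀ => ⟨fun h ψ hψ => hψ b₀ c₀ h, fun h => ?_⟩⟩
  by_contra hnot
  have hnf : NotForks L Ind φ b₀ c₀ := not_not.1 hnot
  have hcons : Consistent T
      (({notRealizedInPred ι φ} ∪ Set.range fun j : ι => predFormula (Sum.inr j)) ∪
        (LHom.sumInl : L →ᴸ pairLang L).onFormula '' {ψ | ψ.Realize (Sum.elim b₀ c₀)}) := by
    refine Consistent.of_finite fun s hs => ?_
    obtain ⟨s', hs', rfl⟩ := Finset.subset_set_image_iff.1 hs
    let σ : L.Formula (Fin m ⊕ ι) := Formula.iInf fun ψ : s' => (ψ : L.Formula (Fin m ⊕ ι))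
    obtain ⟨b, c, hbc, hσ⟩ : ∃ b c, (b, c) ∈ ForkingSet L ι Ind φ ∧
        σ.Realize (Sum.elim b c) := by
      by_contra hcon
      push Not at hcon
      exact h σ.not hcon (Formula.realize_iInf.2 fun ψ => hs' ψ.2)
    rw [Formula.realize_iInf] at hσ
    have hB : #(Set.range b) ≤ κ := (Set.finite_range b).lt_aleph0.le.trans hκ
    have hD : #(Set.range c) ≤ κ := mk_range_le.trans (hι.le.trans hlamκ)
    obtain ⟨N, hN, hbN, hcN, hi⟩ := exists_densityProperty hC hInd hκ hL hκμ hlamκ hB hD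
    have : Theory.Model (L := pairLang L) N.M T := hmod N hN
    refine Consistent.of_model N.M (Sum.elim (fun i => ⟨b i, hbN ⟨i, rfl⟩⟩)
      fun j => ⟨c j, N.subset (hcN ⟨j, rfl⟩)⟩) ?_
    rintro χ ((rfl | ⟨j, rfl⟩) | hχ)
    · -- Realizations in the predicate are independent from `b` over `c`.
      rw [N.realize_notRealizedInPred]
      rintro ⟨a, haP, ha⟩
      exact hbc ⟨a, ha, hInd.mono_left N.small_pred (hD.trans_lt hκμ) (hB.trans_lt hκμ)
        (Set.range_subset_iff.2 haP) hi⟩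
    · rw [N.realize_predFormula]
      exact hcN ⟨j, rfl⟩
    · obtain ⟨ψ, hψ, rfl⟩ := Finset.mem_image.1 hχ
      rw [N.realize_onFormula]
      convert hσ ⟨ψ, hψ⟩ using 1
      ext (_ | _) <;> rfl
  have hV : #(Fin m ⊕ ι) ≤ κ := by
    rw [mk_sum]
    refine add_le_of_le hκ ?_ ?_
    · simpa using natCast_lt_aleph0 (n := m).le.trans hκ
    · simpa using hι.le.trans hlamκ
  obtain ⟨N, hNT, hNsat, y, hy⟩ := exists_saturated_smallPair hC hκ hL hκμ hT
    (hV.trans (cantor κ).le) hcons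
  have hN := hsat N hNT hNsat
  have hyr : ∀ ψ : L.Formula (Fin m ⊕ ι), ψ.Realize (Sum.elim b₀ c₀) →
      ψ.Realize fun i => (y i : C) := fun ψ hψ => by
    rw [← N.realize_onFormula]
    exact hy _ (Or.inr ⟨ψ, hψ, rfl⟩)
  obtain ⟨σ, hσ⟩ := hC.isStronglyHomogeneous (Fin m ⊕ ι) (hV.trans_lt hκμ) (Sum.elim b₀ c₀)
    (fun i => (y i : C)) fun ψ => ⟨hyr ψ, fun h1 => by
      by_contra h2
      exact hyr ψ.not h2 h1⟩
  have hb : σ ∘ b₀ = fun i => (y (Sum.inl i) : C) := funext fun i => hσ (Sum.inl i)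
  have hc : σ ∘ c₀ = fun j => (y (Sum.inr j) : C) := funext fun j => hσ (Sum.inr j)
  have hnf' := hnf.map hInd hμ (hι.trans_le hlamμ) σ
  rw [hb, hc] at hnf'
  refine (N.realize_notRealizedInPred φ y).1 (hy _ (Or.inl (Or.inl rfl)))
    (hN.exists_realize hC hInd hlam hlamμ hι φ (fun i => (y _).2) (fun j => ?_) hnf')
  rw [← N.realize_predFormula (Sum.inr j) y]
  exact hy _ (Or.inl (Or.inr ⟨j, rfl⟩))

theorem axiomatizes_densityScheme (hC : IsMonster L C μ)
    (hInd : IsIndependenceRelation L μ Ind) (hlam : ℵ₀ ≤ lam) (hlamκ : lam ≤ κ) (hκμ : κ < μ)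
    {Γ : TypeFamily.{u, v, w} L} (hΓ : DefinesForking lam Ind Γ) :
    Axiomatizes κ (pairTheory L C ∪ densityScheme lam Γ)
      (DensityProperty (L := L) (μ := μ) lam Ind) := by
  have hμ : ℵ₀ ≤ μ := hC.isStrongLimit.aleph0_le
  have hlamμ : lam ≤ μ := hlamκ.trans hκμ.le
  refine ⟨Set.subset_union_left, fun N hN => ?_, fun N hN hsat => ?_⟩
  · exact N.models_pairTheory.union ((models_densityScheme_iff hInd hμ hlam hΓ N).2
      (hN.densityCondition hC hInd hlam hlamμ))
  · exact ((models_densityScheme_iff hInd hμ hlam hΓ N).1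
      (Theory.Model.mono hN Set.subset_union_right)).densityProperty hInd hμ hlamκ hlamμ hsat

end Low

end LovelyPairs

theorem mainTheorem7 {L : FirstOrder.Language.{u, v}} {C : Type w} [L.Structure C] [Nonempty C]
    {μ κ lam : Cardinal.{w}} (hC : LovelyPairs.IsMonster L C μ)
    (Ind : Set C → Set C → Set C → Prop)
    (hInd : LovelyPairs.IsIndependenceRelation L μ Ind)
    (hκ₀ : LovelyPairs.kappaZero μ Ind < κ)
    (hT : Cardinal.lift.{w} (max ℵ₀ L.card) < Cardinal.lift.{max u v} κ)
    (hκ : κ < μ) (hlam : ℵ₀ ≤ lam) (hlamκ : lam ≤ κ) :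
    (LovelyPairs.IsLow L lam Ind ↔
      LovelyPairs.IsFirstOrderProperty κ
        (LovelyPairs.DensityProperty (L := L) (μ := μ) lam Ind)) ∧
    (LovelyPairs.IsLow L lam Ind →
      (∃ Γ : LovelyPairs.TypeFamily.{u, v, w} L, LovelyPairs.DefinesForking lam Ind Γ) ∧
      ∀ Γ : LovelyPairs.TypeFamily.{u, v, w} L, LovelyPairs.DefinesForking lam Ind Γ →
        LovelyPairs.Axiomatizes κ
          (LovelyPairs.pairTheory L C ∪ LovelyPairs.densityScheme lam Γ)
          (LovelyPairs.DensityProperty (L := L) (μ := μ) lam Ind) ∧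
        ∀ N : LovelyPairs.SmallPair L C μ,
          N.Models (LovelyPairs.densityScheme lam Γ) ↔ LovelyPairs.DensityCondition lam Ind N) := by
  have hT' : Cardinal.lift.{w} (max ℵ₀ L.card) ≤ Cardinal.lift.{max u v} κ := hT.le
  rw [lift_max, max_le_iff, lift_aleph0, aleph0_le_lift] at hT'
  obtain ⟨hκω, hL⟩ := hT'
  have hμ := hC.isStrongLimit.aleph0_le
  have hax {Γ : LovelyPairs.TypeFamily.{u, v, w} L} (hΓ : LovelyPairs.DefinesForking lam Ind Γ) :=
    LovelyPairs.axiomatizes_densityScheme hC hInd hlam hlamκ hκ hΓ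
  refine ⟨⟨fun h => ?_, LovelyPairs.isLow_of_isFirstOrderProperty hC hInd hκω hL hκ hlam hlamκ⟩,
    fun h => ⟨LovelyPairs.exists_definesForking h, fun Γ hΓ => ⟨hax hΓ, fun N =>
      LovelyPairs.models_densityScheme_iff hInd hμ hlam hΓ N⟩⟩⟩
  obtain ⟨Γ, hΓ⟩ := LovelyPairs.exists_definesForking h
  exact ⟨_, hax hΓ⟩
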